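/- Let $(M,g)$ and $(N,g_N)$ be smooth Riemannian manifolds and let $\pi:(M,g)\to (N,g_N)$ be a Riemannian submersion, that is, a smooth submersion such that $d\pi_x$ is isometric on the horizontal space $H_x=\mathcal V_x^{\perp_g}$, where $\mathcal V_x=\ker d\pi_x$ is the vertical space. Assume that the fibers of $\pi$ are totally geodesic, i.e. $\nabla_UW$ is vertical for all vertical vector fields $U,W$, where $\nabla$ is the Levi-Civita connection of $g$. Let $J$ be a complex structure on $M$, compatible with $g$, such that $(M,g,J)$ is Kähler (that is, $J^2=-1$, $g(J\cdot,J\cdot)=g$ and $\nabla J=0$), and assume that $J$ preserves both $\mathcal V$ and $H$. Let $\hat g$ be the Riemannian metric on $M$ with $$\hat g=\tfrac12 g \text{ on } \mathcal V,\qquad \hat g=g \text{ on } H,\qquad \hat g(\mathcal V,H)=0,$$ and let $\hat J$ be the almost complex structure with $\hat J|_{\mathcal V}=-J|_{\mathcal V}$ and $\hat J|_{H}=J|_{H}$. Let $\hat\nabla$ be the Levi-Civita connection of $\hat g$. Then: 1. $(M,\hat g,\hat J)$ is nearly Kähler: it is almost Hermitian ($\hat J$ is smooth, $\hat J^2=-1$,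 $\hat g(\hat J\cdot,\hat J\cdot)=\hat g$) and $(\hat\nabla_X\hat J)X=0$ for every vector field $X$ on $M$. 2. The distributions $\mathcal V$ and $H$ are parallel with respect to the canonical Hermitian connection $\overline\nabla_XY=\hat\nabla_XY+\tfrac12(\hat\nabla_X\hat J)\hat JY$ of $(M,\hat g,\hat J)$: if $Y$ is a section of $\mathcal V$ (respectively $H$), then so is $\overline\nabla_XY$ for every vector field $X$. 3. Consequently $\overline\nabla$ has reduced holonomy: for every $x\in M$ the holonomy group of $\overline\nabla$ at $x$ preserves the subspaces $\mathcal V_x$ and $H_x$ of $T_xM$. In particular, if $0<\dim N<\dim M$, the holonomy representation on $T_xM$ is reducible for every $x\in M$. -/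

import Mathlib

open Bundle FiberBundle VectorField
open scoped Manifold ContDiff

set_option linter.unusedSectionVars false

noncomputable section

variable {E : Type*} [NormedAddCommGroup E] [NormedSpace ℝ E] [FiniteDimensional ℝ E]
  {M : Type*} [TopologicalSpace M] [ChartedSpace E M] [IsManifold 𝓘(ℝ, E) ∞ M]
  {EN : Type*} [NormedAddCommGroup EN] [NormedSpace ℝ EN] [FiniteDimensional ℝ EN]
  {N : Type*} [TopologicalSpace N] [ChartedSpace EN N] [IsManifold 𝓘(ℝ, EN) ∞ N]

/-! ### Riemannian metrics and the Levi-Civita connection -/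

/-- A smooth Riemannian metric on the manifold `M`. -/
abbrev RiemMetric (E : Type*) [NormedAddCommGroup E] [NormedSpace ℝ E]
    (M : Type*) [TopologicalSpace M] [ChartedSpace E M] [IsManifold 𝓘(ℝ, E) ∞ M] :=
  ContMDiffRiemannianMetric 𝓘(ℝ, E) ∞ E (fun x : M => TangentSpace 𝓘(ℝ, E) x)

/-- A connection on the tangent bundle of `M`, sending a vector field `Y` to `X ↦ ∇_X Y`
(Mathlib writes `D Y x u` for `∇_u Y`, where `u` is a tangent vector at `x`). -/
abbrev AffineConnection (E : Type*) [NormedAddCommGroup E] [NormedSpace ℝ E]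
    (M : Type*) [TopologicalSpace M] [ChartedSpace E M] [IsManifold 𝓘(ℝ, E) ∞ M] :=
  CovariantDerivative 𝓘(ℝ, E) E (fun x : M => TangentSpace 𝓘(ℝ, E) x)

/-- `D` is the Levi-Civita connection of `g`: it has no torsion and preserves `g`. -/
structure IsLeviCivita (g : RiemMetric E M) (D : AffineConnection E M) : Prop where
  torsion_eq_zero : D.torsion = 0
  metric : ∀ (x : M) (Y Z : Π y : M, TangentSpace 𝓘(ℝ, E) y) (u : TangentSpace 𝓘(ℝ, E) x),
    MDiffAt (T% Y) x → MDiffAt (T% Z) x →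
    d% (fun y => g.inner y (Y y) (Z y)) x u
      = g.inner x (D Y x u) (Z x) + g.inner x (Y x) (D Z x u)

/-- The right-hand side of the Koszul formula for `2 g(∇_X Y, Z)` at `x`. -/
def koszul (g : RiemMetric E M) (Y X Z : Π y : M, TangentSpace 𝓘(ℝ, E) y) (x : M) : ℝ :=
  d% (fun y => g.inner y (Y y) (Z y)) x (X x) + d% (fun y => g.inner y (X y) (Z y)) x (Y x)
    - d% (fun y => g.inner y (X y) (Y y)) x (Z x)
    + g.inner x (mlieBracket 𝓘(ℝ, E) X Y x) (Z x)
    - g.inner x (mlieBracket 𝓘(ℝ, E) X Z x) (Y x)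
    - g.inner x (mlieBracket 𝓘(ℝ, E) Y Z x) (X x)

theorem RiemMetric.mdiffAt (g : RiemMetric E M) {x : M} {Y Z : Π y : M, TangentSpace 𝓘(ℝ, E) y}
    (hY : MDiffAt (T% Y) x) (hZ : MDiffAt (T% Z) x) :
    MDiffAt (fun y => g.inner y (Y y) (Z y)) x := by
  let _ : RiemannianBundle (fun x : M => TangentSpace 𝓘(ℝ, E) x) := ⟨g.toRiemannianMetric⟩
  exact MDifferentiableAt.inner_bundle (F := E) (E := fun x : M => TangentSpace 𝓘(ℝ, E) x) hY hZ

theorem koszul_tensorial_left (g : RiemMetric E M) {Y Z : Π y : M, TangentSpace 𝓘(ℝ, E) y} {x : M}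
    (hY : MDiffAt (T% Y) x) (hZ : MDiffAt (T% Z) x) :
    TensorialAt 𝓘(ℝ, E) E (fun X => koszul g Y X Z x) x where
  smul {f X} hf hX := by
    have h1 : d% (fun y => g.inner y ((f • X) y) (Z y)) x =
      d% (fun y => f y * g.inner y (X y) (Z y)) x := by simp
    have h2 : d% (fun y => g.inner y ((f • X) y) (Y y)) x =
      d% (fun y => f y * g.inner y (X y) (Y y)) x := by simp
    simp only [koszul, h1, h2]
    rw [mvfderiv_fun_mul hf (g.mdiffAt hX hZ), mvfderiv_fun_mul hf (g.mdiffAt hX hY),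
      mlieBracket_smul_left hf hX, mlieBracket_smul_left hf hX]
    simp
    ring
  add {X X'} hX hX' := by
    have h1 : d% (fun y => g.inner y ((X + X') y) (Z y)) x =
      d% (fun y => g.inner y (X y) (Z y) + g.inner y (X' y) (Z y)) x := by simp
    have h2 : d% (fun y => g.inner y ((X + X') y) (Y y)) x =
      d% (fun y => g.inner y (X y) (Y y) + g.inner y (X' y) (Y y)) x := by simp
    simp only [koszul, h1, h2]
    rw [mvfderiv_fun_add (g.mdiffAt hX hZ) (g.mdiffAt hX' hZ),
      mvfderiv_fun_add (g.mdiffAt hX hY) (g.mdiffAt hX' hY),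
      mlieBracket_add_left hX hX', mlieBracket_add_left hX hX']
    simp
    ring

theorem koszul_tensorial_right (g : RiemMetric E M) {Y X : Π y : M, TangentSpace 𝓘(ℝ, E) y} {x : M}
    (hY : MDiffAt (T% Y) x) (hX : MDiffAt (T% X) x) :
    TensorialAt 𝓘(ℝ, E) E (fun Z => koszul g Y X Z x) x where
  smul {f Z} hf hZ := by
    have h1 : d% (fun y => g.inner y (Y y) ((f • Z) y)) x =
      d% (fun y => f y * g.inner y (Y y) (Z y)) x := by simp
    have h2 : d% (fun y => g.inner y (X y) ((f • Z) y)) x =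
      d% (fun y => f y * g.inner y (X y) (Z y)) x := by simp
    simp only [koszul, h1, h2]
    rw [mvfderiv_fun_mul hf (g.mdiffAt hY hZ), mvfderiv_fun_mul hf (g.mdiffAt hX hZ),
      mlieBracket_smul_right hf hZ, mlieBracket_smul_right hf hZ]
    simp [g.symm x (Z x) (X x), g.symm x (Z x) (Y x)]
    ring
  add {Z Z'} hZ hZ' := by
    have h1 : d% (fun y => g.inner y (Y y) ((Z + Z') y)) x =
      d% (fun y => g.inner y (Y y) (Z y) + g.inner y (Y y) (Z' y)) x := by simp
    have h2 : d% (fun y => g.inner y (X y) ((Z + Z') y)) x =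
      d% (fun y => g.inner y (X y) (Z y) + g.inner y (X y) (Z' y)) x := by simp
    simp only [koszul, h1, h2]
    rw [mvfderiv_fun_add (g.mdiffAt hY hZ) (g.mdiffAt hY hZ'),
      mvfderiv_fun_add (g.mdiffAt hX hZ) (g.mdiffAt hX hZ'),
      mlieBracket_add_right hZ hZ', mlieBracket_add_right hZ hZ']
    simp
    ring

theorem RiemMetric.ext_inner (g : RiemMetric E M) {x : M} {u v : TangentSpace 𝓘(ℝ, E) x}
    (h : ∀ w, g.inner x u w = g.inner x v w) : u = v := by
  by_contra hne
  have := g.pos x (u - v) (sub_ne_zero.2 hne)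
  have e : g.inner x (u - v) (u - v) = 0 := by
    rw [map_sub (g.inner x) u v, sub_apply, h, sub_self]
  exact this.ne' e

/-- Riesz representation of a bilinear form. -/
theorem RiemMetric.exists_represent (g : RiemMetric E M) {x : M}
    (B : TangentSpace 𝓘(ℝ, E) x →L[ℝ] TangentSpace 𝓘(ℝ, E) x →L[ℝ] ℝ) :
    ∃ L : TangentSpace 𝓘(ℝ, E) x →L[ℝ] TangentSpace 𝓘(ℝ, E) x,
      ∀ u w, g.inner x (L u) w = B u w := by
  have : FiniteDimensional ℝ (TangentSpace 𝓘(ℝ, E) x) := inferInstanceAs (FiniteDimensional ℝ E)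
  have : T2Space (TangentSpace 𝓘(ℝ, E) x) := inferInstanceAs (T2Space E)
  let G : TangentSpace 𝓘(ℝ, E) x →ₗ[ℝ] Module.Dual ℝ (TangentSpace 𝓘(ℝ, E) x) :=
    (ContinuousLinearMap.coeLM ℝ).comp (g.inner x).toLinearMap
  let B' : TangentSpace 𝓘(ℝ, E) x →ₗ[ℝ] Module.Dual ℝ (TangentSpace 𝓘(ℝ, E) x) :=
    (ContinuousLinearMap.coeLM ℝ).comp B.toLinearMap
  have hG : Function.Injective G := fun u v h => g.ext_inner fun w => congr($h w)
  let e := LinearEquiv.ofInjectiveOfFinrankEq G hG (Subspace.dual_finrank_eq).symm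
  have he : ∀ f w, g.inner x (e.symm f) w = f w := fun f w => by
    have : G (e.symm f) = f := e.apply_symm_apply f
    exact congr($this w)
  exact ⟨LinearMap.toContinuousLinearMap (e.symm.toLinearMap.comp B'), fun u w => he _ _⟩

theorem exists_koszul (g : RiemMetric E M) {Y : Π y : M, TangentSpace 𝓘(ℝ, E) y} {x : M}
    (hY : MDiffAt (T% Y) x) :
    ∃ L : TangentSpace 𝓘(ℝ, E) x →L[ℝ] TangentSpace 𝓘(ℝ, E) x,
      ∀ X Z : Π y : M, TangentSpace 𝓘(ℝ, E) y, MDiffAt (T% X) x → MDiffAt (T% Z) x →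
        2 * g.inner x (L (X x)) (Z x) = koszul g Y X Z x := by
  obtain ⟨L, hL⟩ := g.exists_represent ((1 / 2 : ℝ) • TensorialAt.mkHom₂
    (fun X Z => koszul g Y X Z x) x (fun Z hZ => koszul_tensorial_left g hY hZ)
    (fun X hX => koszul_tensorial_right g hY hX))
  refine ⟨L, fun X Z hX hZ => ?_⟩
  have h := TensorialAt.mkHom₂_apply (Φ := fun X Z => koszul g Y X Z x)
    (fun Z hZ => koszul_tensorial_left g hY hZ)
    (fun X hX => koszul_tensorial_right g hY hX) hX hZ
  rw [hL, ← h]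
  simp

theorem IsLeviCivita.koszul_eq {g : RiemMetric E M} {D : AffineConnection E M}
    (h : IsLeviCivita g D) {x : M} {Y X Z : Π y : M, TangentSpace 𝓘(ℝ, E) y}
    (hY : MDiffAt (T% Y) x) (hX : MDiffAt (T% X) x) (hZ : MDiffAt (T% Z) x) :
    2 * g.inner x (D Y x (X x)) (Z x) = koszul g Y X Z x := by
  have ht : ∀ {X Y : Π y : M, TangentSpace 𝓘(ℝ, E) y} {x : M}, MDiffAt (T% X) x →
      MDiffAt (T% Y) x → D Y x (X x) - D X x (Y x) = mlieBracket 𝓘(ℝ, E) X Y x :=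
    D.torsion_eq_zero_iff.1 h.torsion_eq_zero
  simp only [koszul, ← ht hX hY, ← ht hX hZ, ← ht hY hZ, h.metric x _ _ _ hY hZ,
    h.metric x _ _ _ hX hZ, h.metric x _ _ _ hX hY, map_sub, sub_apply]
  rw [g.symm x (Y x) (D Z x (X x)), g.symm x (X x) (D Z x (Y x)), g.symm x (X x) (D Y x (Z x))]
  ring

/-- The fundamental theorem of Riemannian geometry (uniqueness part). -/
theorem IsLeviCivita.unique {g : RiemMetric E M} {D D' : AffineConnection E M}
    (h : IsLeviCivita g D) (h' : IsLeviCivita g D') {x : M}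
    {Y : Π y : M, TangentSpace 𝓘(ℝ, E) y} (hY : MDiffAt (T% Y) x) : D Y x = D' Y x := by
  ext u
  refine g.ext_inner fun w => ?_
  have e := (h.koszul_eq hY (mdifferentiableAt_extend 𝓘(ℝ, E) E u)
    (mdifferentiableAt_extend 𝓘(ℝ, E) E w)).trans
    (h'.koszul_eq hY (mdifferentiableAt_extend 𝓘(ℝ, E) E u)
    (mdifferentiableAt_extend 𝓘(ℝ, E) E w)).symm
  simpa using e

/-- The fundamental theorem of Riemannian geometry (existence part). -/
theorem exists_isLeviCivita (g : RiemMetric E M) : ∃ D : AffineConnection E M, IsLeviCivita g D := by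
  classical
  let D : (Π x : M, TangentSpace 𝓘(ℝ, E) x) →
      (Π x : M, TangentSpace 𝓘(ℝ, E) x →L[ℝ] TangentSpace 𝓘(ℝ, E) x) :=
    fun Y x => if h : MDiffAt (T% Y) x then (exists_koszul g h).choose else 0
  have hD : ∀ {x : M} {Y X Z : Π y : M, TangentSpace 𝓘(ℝ, E) y}, MDiffAt (T% Y) x →
      MDiffAt (T% X) x → MDiffAt (T% Z) x →
      2 * g.inner x (D Y x (X x)) (Z x) = koszul g Y X Z x := by
    intro x Y X Z hY hX hZ
    simp only [D, dif_pos hY]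
    exact (exists_koszul g hY).choose_spec X Z hX hZ
  have hext : ∀ {x : M} {A B : TangentSpace 𝓘(ℝ, E) x →L[ℝ] TangentSpace 𝓘(ℝ, E) x},
      (∀ X Z : Π y : M, TangentSpace 𝓘(ℝ, E) y, MDiffAt (T% X) x → MDiffAt (T% Z) x →
        2 * g.inner x (A (X x)) (Z x) = 2 * g.inner x (B (X x)) (Z x)) → A = B := by
    intro x A B h
    ext u
    refine g.ext_inner fun w => ?_
    have := h (extend E u) (extend E w) (mdifferentiableAt_extend ..) (mdifferentiableAt_extend ..)
    simpa using this
  have hcov : IsCovariantDerivativeOn E D Set.univ :=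
  { add := by
      intro Y Y' x hY hY' _
      refine hext fun X Z hX hZ => ?_
      have h1 : d% (fun y => g.inner y ((Y + Y') y) (Z y)) x =
        d% (fun y => g.inner y (Y y) (Z y) + g.inner y (Y' y) (Z y)) x := by simp
      have h2 : d% (fun y => g.inner y (X y) ((Y + Y') y)) x =
        d% (fun y => g.inner y (X y) (Y y) + g.inner y (X y) (Y' y)) x := by simp
      have e1 := hD hY hX hZ
      have e2 := hD hY' hX hZ
      rw [hD (mdifferentiableAt_add_section hY hY') hX hZ]
      simp only [add_apply, map_add, mul_add, e1, e2]
      simp only [koszul, h1, h2]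
      rw [mvfderiv_fun_add (g.mdiffAt hY hZ) (g.mdiffAt hY' hZ),
        mvfderiv_fun_add (g.mdiffAt hX hY) (g.mdiffAt hX hY'),
        mlieBracket_add_right hY hY', mlieBracket_add_left hY hY']
      simp
      ring
    leibniz := by
      intro Y f x hY hf _
      refine hext fun X Z hX hZ => ?_
      have h1 : d% (fun y => g.inner y ((f • Y) y) (Z y)) x =
        d% (fun y => f y * g.inner y (Y y) (Z y)) x := by simp
      have h2 : d% (fun y => g.inner y (X y) ((f • Y) y)) x =
        d% (fun y => f y * g.inner y (X y) (Y y)) x := by simp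
      have e1 := hD hY hX hZ
      rw [hD (hf.smul_section hY) hX hZ]
      have e3 : 2 * g.inner x ((f x • D Y x + (d% f x).smulRight (Y x)) (X x)) (Z x)
          = f x * koszul g Y X Z x + 2 * (d% f x (X x)) * g.inner x (Y x) (Z x) := by
        rw [← e1]; simp; ring
      rw [e3]
      simp only [koszul, h1, h2]
      rw [mvfderiv_fun_mul hf (g.mdiffAt hY hZ), mvfderiv_fun_mul hf (g.mdiffAt hX hY),
        mlieBracket_smul_right hf hY, mlieBracket_smul_left hf hY]
      simp [g.symm x (Y x) (X x)]
      ring }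
  refine ⟨⟨D, hcov⟩, ?_, ?_⟩
  · rw [CovariantDerivative.torsion_eq_zero_iff]
    intro X Y x hX hY
    refine g.ext_inner fun w => ?_
    have hw : MDiffAt (T% (extend E w : Π y : M, TangentSpace 𝓘(ℝ, E) y)) x :=
      mdifferentiableAt_extend ..
    have e1 := hD hY hX hw
    have e2 := hD hX hY hw
    simp only [extend_apply_self] at e1 e2
    have hs : (fun y => g.inner y (X y) (Y y)) = fun y => g.inner y (Y y) (X y) :=
      funext fun y => g.symm ..
    simp only [koszul, hs, extend_apply_self] at e1 e2
    rw [mlieBracket_swap_apply (V := Y) (W := X)] at e2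
    simp only [map_sub, map_neg, sub_apply, neg_apply]
      at e1 e2 ⊢
    change g.inner x (D Y x (X x)) w - g.inner x (D X x (Y x)) w = _
    linarith
  · intro x Y Z u hY hZ
    have hu : MDiffAt (T% (extend E u : Π y : M, TangentSpace 𝓘(ℝ, E) y)) x :=
      mdifferentiableAt_extend ..
    have e1 := hD hY hu hZ
    have e2 := hD hZ hu hY
    have hs : (fun y => g.inner y (Z y) (Y y)) = fun y => g.inner y (Y y) (Z y) :=
      funext fun y => g.symm ..
    simp only [koszul, hs, extend_apply_self] at e1 e2
    rw [mlieBracket_swap_apply (V := Z) (W := Y)] at e2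
    simp only [map_neg, neg_apply] at e1 e2
    change _ = g.inner x (D Y x u) (Z x) + g.inner x (Y x) (D Z x u)
    rw [g.symm x (Y x) (D Z x u)]
    linarith
/-- The Levi-Civita connection of `g`. By `IsLeviCivita.unique` the choice is immaterial on
differentiable vector fields, and it is never used on others. -/
def leviCivita (g : RiemMetric E M) : AffineConnection E M := (exists_isLeviCivita g).choose

/-! ### Almost Hermitian structures -/

/-- A field of endomorphisms of the tangent spaces of `M`. -/
abbrev EndField (E : Type*) [NormedAddCommGroup E] [NormedSpace ℝ E]
    (M : Type*) [TopologicalSpace M] [ChartedSpace E M] :=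
  Π x : M, TangentSpace 𝓘(ℝ, E) x →L[ℝ] TangentSpace 𝓘(ℝ, E) x

/-- `(M, g, J)` is almost Hermitian: `J` is a smooth field of endomorphisms with `J² = -1`,
and `g` is `J`-invariant. -/
structure IsAlmostHermitian (g : RiemMetric E M) (J : EndField E M) : Prop where
  smooth : ContMDiff 𝓘(ℝ, E) (𝓘(ℝ, E).prod 𝓘(ℝ, E →L[ℝ] E)) ∞
    (fun x => TotalSpace.mk' (E →L[ℝ] E)
      (E := fun x : M => TangentSpace 𝓘(ℝ, E) x →L[ℝ] TangentSpace 𝓘(ℝ, E) x) x (J x))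
  sq : ∀ x u, J x (J x u) = -u
  compatible : ∀ x u v, g.inner x (J x u) (J x v) = g.inner x u v

/-- The covariant derivative of `J`: `covDerivEnd D J Y x u` is
`(∇_u J) Y = ∇_u (J Y) - J (∇_u Y)` at the point `x`. -/
def covDerivEnd (D : AffineConnection E M) (J : EndField E M)
    (Y : Π y : M, TangentSpace 𝓘(ℝ, E) y) (x : M) :
    TangentSpace 𝓘(ℝ, E) x →L[ℝ] TangentSpace 𝓘(ℝ, E) x :=
  D (fun y => J y (Y y)) x - (J x).comp (D Y x)

/-- `(M, g, J)` is Kähler: it is almost Hermitian and `∇J = 0`. -/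
structure IsKahler (g : RiemMetric E M) (J : EndField E M) : Prop where
  almostHermitian : IsAlmostHermitian g J
  parallel : ∀ (x : M) (Y : Π y : M, TangentSpace 𝓘(ℝ, E) y), MDiffAt (T% Y) x →
    covDerivEnd (leviCivita g) J Y x = 0

/-- `(M, g, J)` is nearly Kähler: it is almost Hermitian and `(∇_X J) X = 0` for all `X`. -/
structure IsNearlyKahler (g : RiemMetric E M) (J : EndField E M) : Prop where
  almostHermitian : IsAlmostHermitian g J
  skew : ∀ (x : M) (X : Π y : M, TangentSpace 𝓘(ℝ, E) y), MDiffAt (T% X) x →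
    covDerivEnd (leviCivita g) J X x (X x) = 0

/-- The canonical Hermitian connection `Y ↦ (X ↦ ∇_X Y + (1/2) (∇_X J) J Y)` of `(M, g, J)`. -/
def canonicalHermitian (g : RiemMetric E M) (J : EndField E M)
    (Y : Π y : M, TangentSpace 𝓘(ℝ, E) y) (x : M) :
    TangentSpace 𝓘(ℝ, E) x →L[ℝ] TangentSpace 𝓘(ℝ, E) x :=
  leviCivita g Y x + (1 / 2 : ℝ) • covDerivEnd (leviCivita g) J (fun y => J y (Y y)) x

/-! ### Parallel distributions, parallel transport and holonomy -/

/-- The distribution `S` is parallel for the connection `D`: if `Y` is a section of `S` and `u` a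
tangent vector, then `∇_u Y` lies in `S`. -/
def IsParallelDistribution
    (D : (Π y : M, TangentSpace 𝓘(ℝ, E) y) → EndField E M)
    (S : Π x : M, Submodule ℝ (TangentSpace 𝓘(ℝ, E) x)) : Prop :=
  ∀ (x : M) (Y : Π y : M, TangentSpace 𝓘(ℝ, E) y), MDiffAt (T% Y) x → (∀ y, Y y ∈ S y) →
    ∀ u, D Y x u ∈ S x

/-- The vector field `Y` along the curve `c`, read in the trivialization of the tangent bundle
that is centered at `c t`. -/
def alongCoord (c : ℝ → M) (Y : Π s : ℝ, TangentSpace 𝓘(ℝ, E) (c s)) (t s : ℝ) : E :=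
  (trivializationAt E (fun x : M => TangentSpace 𝓘(ℝ, E) x) (c t) ⟨c s, Y s⟩).2

/-- The covariant derivative at time `t` of a vector field `Y` along a curve `c` defined on `I`.
If `Y = ∑ y_i e_i` in the frame `e_i` given by the trivialization of the tangent bundle centered
at `c t`, this is `∑ y_i'(t) e_i + y_i(t) ∇_{c'(t)} e_i`; the vector field
`extend E (Y t) = ∑ y_i(t) e_i` has constant coefficients in that frame. -/
def covDerivAlong
    (D : (Π y : M, TangentSpace 𝓘(ℝ, E) y) → EndField E M) (c : ℝ → M) (I : Set ℝ)
    (Y : Π s : ℝ, TangentSpace 𝓘(ℝ, E) (c s)) (t : ℝ) : TangentSpace 𝓘(ℝ, E) (c t) :=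
  (trivializationAt E (fun x : M => TangentSpace 𝓘(ℝ, E) x) (c t)).symm (c t)
      (derivWithin (alongCoord c Y t) I t)
    + D (extend E (Y t)) (c t) (mfderivWithin 𝓘(ℝ, ℝ) 𝓘(ℝ, E) c I t (1 : ℝ))

/-- `Y` is a parallel vector field along the curve `c` defined on `I`. -/
def IsParallelAlong
    (D : (Π y : M, TangentSpace 𝓘(ℝ, E) y) → EndField E M) (c : ℝ → M) (I : Set ℝ)
    (Y : Π s : ℝ, TangentSpace 𝓘(ℝ, E) (c s)) : Prop :=
  ∀ t ∈ I, DifferentiableWithinAt ℝ (alongCoord c Y t) I t ∧ covDerivAlong D c I Y t = 0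

/-- `IsParallelTransport D x y τ`: the linear map `τ : T_x M → T_y M` is the parallel transport of
`D` along some piecewise `C¹` curve from `x` to `y`. -/
inductive IsParallelTransport
    (D : (Π y : M, TangentSpace 𝓘(ℝ, E) y) → EndField E M) :
    (x y : M) → (TangentSpace 𝓘(ℝ, E) x →ₗ[ℝ] TangentSpace 𝓘(ℝ, E) y) → Prop
  | curve (c : ℝ → M) (a b : ℝ) (hab : a < b)
      (hc : ContMDiffOn 𝓘(ℝ, ℝ) 𝓘(ℝ, E) 1 c (Set.Icc a b))
      (τ : TangentSpace 𝓘(ℝ, E) (c a) →ₗ[ℝ] TangentSpace 𝓘(ℝ, E) (c b))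
      (hτ : ∀ v, ∃ Y : Π s : ℝ, TangentSpace 𝓘(ℝ, E) (c s),
        IsParallelAlong D c (Set.Icc a b) Y ∧ Y a = v ∧ Y b = τ v) :
      IsParallelTransport D (c a) (c b) τ
  | trans (x y z : M) (σ : TangentSpace 𝓘(ℝ, E) x →ₗ[ℝ] TangentSpace 𝓘(ℝ, E) y)
      (τ : TangentSpace 𝓘(ℝ, E) y →ₗ[ℝ] TangentSpace 𝓘(ℝ, E) z)
      (hσ : IsParallelTransport D x y σ) (hτ : IsParallelTransport D y z τ) :
      IsParallelTransport D x z (τ.comp σ)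

/-- The holonomy group of `D` at `x`: the group of parallel transports along piecewise `C¹` loops
based at `x`. -/
def holonomyGroup (D : (Π y : M, TangentSpace 𝓘(ℝ, E) y) → EndField E M) (x : M) :
    Subgroup (TangentSpace 𝓘(ℝ, E) x ≃ₗ[ℝ] TangentSpace 𝓘(ℝ, E) x) :=
  Subgroup.closure {τ | IsParallelTransport D x x τ.toLinearMap}

/-- The holonomy representation of `D` at every point has a proper nonzero invariant subspace. -/
def HasReducibleHolonomy (D : (Π y : M, TangentSpace 𝓘(ℝ, E) y) → EndField E M) : Prop :=
  ∀ x : M, ∃ W : Submodule ℝ (TangentSpace 𝓘(ℝ, E) x), W ≠ ⊥ ∧ W ≠ ⊤ ∧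
    ∀ τ ∈ holonomyGroup D x, ∀ w ∈ W, τ w ∈ W

/-! ### Riemannian submersions -/

/-- The vertical space at `x`: the kernel of `dp_x`, tangent to the fiber of `p` through `x`. -/
def verticalSpace (E EN : Type*) [NormedAddCommGroup E] [NormedSpace ℝ E]
    [NormedAddCommGroup EN] [NormedSpace ℝ EN] {M N : Type*} [TopologicalSpace M]
    [ChartedSpace E M] [TopologicalSpace N] [ChartedSpace EN N] (p : M → N) (x : M) : Submodule ℝ (TangentSpace 𝓘(ℝ, E) x) :=
  (mfderiv 𝓘(ℝ, E) 𝓘(ℝ, EN) p x).ker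

variable (EN) in
/-- The horizontal space at `x`: the `g`-orthogonal complement of the vertical space. -/
def horizontalSpace (g : RiemMetric E M) (p : M → N) (x : M) :
    Submodule ℝ (TangentSpace 𝓘(ℝ, E) x) where
  carrier := {v | ∀ u ∈ verticalSpace E EN p x, g.inner x u v = 0}
  add_mem' ha hb u hu := by rw [map_add, ha u hu, hb u hu, add_zero]
  zero_mem' u _ := map_zero _
  smul_mem' c a ha u hu := by rw [map_smul, ha u hu, smul_zero]

variable (EN) in
theorem isCompl_vertical_horizontal (g : RiemMetric E M) (p : M → N) (x : M) :
    IsCompl (verticalSpace E EN p x) (horizontalSpace EN g p x) := by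
  have : FiniteDimensional ℝ (TangentSpace 𝓘(ℝ, E) x) := inferInstanceAs (FiniteDimensional ℝ E)
  let B : LinearMap.BilinForm ℝ (TangentSpace 𝓘(ℝ, E) x) :=
    (ContinuousLinearMap.coeLM ℝ).comp (g.inner x).toLinearMap
  have hs : ∀ u v, B u v = g.inner x u v := fun _ _ => rfl
  have hB : B.IsSymm := ⟨fun u v => g.symm x u v⟩
  have key : IsCompl (verticalSpace E EN p x)
      (B.orthogonal (verticalSpace E EN p x)) := by
    apply LinearMap.BilinForm.isCompl_orthogonal_of_restrict_nondegenerate hB.isRefl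
    refine ⟨fun u hu => ?_, fun u hu => ?_⟩ <;>
    · by_contra h
      exact (g.pos x u (by simpa using h)).ne' (hu u)
  exact key

/-- `p : (M, g) → (N, gN)` is a Riemannian submersion: a smooth submersion whose differential
is isometric on horizontal vectors. -/
structure IsRiemannianSubmersion (g : RiemMetric E M) (gN : RiemMetric EN N) (p : M → N) : Prop where
  smooth : ContMDiff 𝓘(ℝ, E) 𝓘(ℝ, EN) ∞ p
  surjective_mfderiv : ∀ x, Function.Surjective (mfderiv 𝓘(ℝ, E) 𝓘(ℝ, EN) p x)
  isometry : ∀ x, ∀ u ∈ horizontalSpace EN g p x, ∀ v ∈ horizontalSpace EN g p x,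
    gN.inner (p x) (mfderiv 𝓘(ℝ, E) 𝓘(ℝ, EN) p x u) (mfderiv 𝓘(ℝ, E) 𝓘(ℝ, EN) p x v)
      = g.inner x u v

variable (EN) in
/-- The orthogonal projection of `T_x M` onto the vertical space. -/
def verticalProj (g : RiemMetric E M) (p : M → N) (x : M) :
    TangentSpace 𝓘(ℝ, E) x →L[ℝ] TangentSpace 𝓘(ℝ, E) x :=
  have : FiniteDimensional ℝ (TangentSpace 𝓘(ℝ, E) x) := inferInstanceAs (FiniteDimensional ℝ E)
  have : T2Space (TangentSpace 𝓘(ℝ, E) x) := inferInstanceAs (T2Space E)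
  LinearMap.toContinuousLinearMap
    (Submodule.projection _ _ (isCompl_vertical_horizontal EN g p x))

variable (EN) in
/-- The orthogonal projection of `T_x M` onto the horizontal space. -/
def horizontalProj (g : RiemMetric E M) (p : M → N) (x : M) :
    TangentSpace 𝓘(ℝ, E) x →L[ℝ] TangentSpace 𝓘(ℝ, E) x :=
  ContinuousLinearMap.id ℝ _ - verticalProj EN g p x

variable (EN) in
theorem verticalProj_mem (g : RiemMetric E M) (p : M → N) (x : M) (u : TangentSpace 𝓘(ℝ, E) x) :
    verticalProj EN g p x u ∈ verticalSpace E EN p x :=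
  Submodule.projection_apply_mem _ u

variable (EN) in
theorem horizontalProj_mem (g : RiemMetric E M) (p : M → N) (x : M) (u : TangentSpace 𝓘(ℝ, E) x) :
    horizontalProj EN g p x u ∈ horizontalSpace EN g p x := by
  have h : verticalProj EN g p x (horizontalProj EN g p x u) = 0 := by
    have := Submodule.projection_apply_of_mem_left
      (isCompl_vertical_horizontal EN g p x) (verticalProj_mem EN g p x u)
    have h2 : verticalProj EN g p x (verticalProj EN g p x u)
      = verticalProj EN g p x u := this
    simp [horizontalProj, h2]
  exact (Submodule.projection_apply_eq_zero_iff _).1 h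

variable (EN) in
theorem proj_add (g : RiemMetric E M) (p : M → N) (x : M) (u : TangentSpace 𝓘(ℝ, E) x) :
    verticalProj EN g p x u + horizontalProj EN g p x u = u := by
  simp [horizontalProj]

variable (EN) in
/-- The bilinear form which is `g / 2` on vertical vectors, `g` on horizontal vectors, and
zero on a vertical and a horizontal vector. -/
def squashedInner (g : RiemMetric E M) (p : M → N) (x : M) :
    TangentSpace 𝓘(ℝ, E) x →L[ℝ] TangentSpace 𝓘(ℝ, E) x →L[ℝ] ℝ :=
  have : FiniteDimensional ℝ (TangentSpace 𝓘(ℝ, E) x) := inferInstanceAs (FiniteDimensional ℝ E)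
  have : T2Space (TangentSpace 𝓘(ℝ, E) x) := inferInstanceAs (T2Space E)
  (LinearMap.mk₂ ℝ (fun u v : TangentSpace 𝓘(ℝ, E) x =>
      (1 / 2) * g.inner x (verticalProj EN g p x u) (verticalProj EN g p x v)
        + g.inner x (horizontalProj EN g p x u) (horizontalProj EN g p x v))
    (fun _ _ _ => by simp only [map_add, add_apply]; ring)
    (fun _ _ _ => by simp only [map_smul, smul_apply, smul_eq_mul]; ring)
    (fun _ _ _ => by simp only [map_add]; ring)
    (fun _ _ _ => by simp only [map_smul, smul_eq_mul]; ring)).toContinuousBilinearMap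

variable (EN) in
theorem squashedInner_apply (g : RiemMetric E M) (p : M → N) (x : M)
    (u v : TangentSpace 𝓘(ℝ, E) x) : squashedInner EN g p x u v =
    (1 / 2) * g.inner x (verticalProj EN g p x u) (verticalProj EN g p x v)
    + g.inner x (horizontalProj EN g p x u) (horizontalProj EN g p x v) := rfl

variable (EN) in
theorem inner_eq_proj (g : RiemMetric E M) (p : M → N) (x : M)
    (u v : TangentSpace 𝓘(ℝ, E) x) : g.inner x u v =
    g.inner x (verticalProj EN g p x u) (verticalProj EN g p x v)
    + g.inner x (horizontalProj EN g p x u) (horizontalProj EN g p x v) := by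
  conv_lhs => rw [← proj_add EN g p x u, ← proj_add EN g p x v]
  have h1 := horizontalProj_mem EN g p x v _ (verticalProj_mem EN g p x u)
  have h2 := horizontalProj_mem EN g p x u _ (verticalProj_mem EN g p x v)
  rw [g.symm] at h2
  simp only [map_add, add_apply, h1, h2]
  ring

variable (EN) in
theorem half_inner_le_squashedInner (g : RiemMetric E M) (p : M → N) (x : M)
    (u : TangentSpace 𝓘(ℝ, E) x) : (1 / 2) * g.inner x u u ≤ squashedInner EN g p x u u := by
  have h : 0 ≤ g.inner x (horizontalProj EN g p x u) (horizontalProj EN g p x u) := by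
    by_cases h0 : horizontalProj EN g p x u = 0
    · simp [h0]
    · exact (g.pos x _ h0).le
  rw [squashedInner_apply, inner_eq_proj EN g p x u u]
  linarith

theorem squashedInner_eq {g : RiemMetric E M} {gN : RiemMetric EN N} {p : M → N}
    (hp : IsRiemannianSubmersion g gN p) (x : M) (u v : TangentSpace 𝓘(ℝ, E) x) :
    squashedInner EN g p x u v = (1 / 2) * g.inner x u v + (1 / 2) *
      gN.inner (p x) (mfderiv 𝓘(ℝ, E) 𝓘(ℝ, EN) p x u) (mfderiv 𝓘(ℝ, E) 𝓘(ℝ, EN) p x v) := by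
  have h : ∀ u, mfderiv 𝓘(ℝ, E) 𝓘(ℝ, EN) p x u
      = mfderiv 𝓘(ℝ, E) 𝓘(ℝ, EN) p x (horizontalProj EN g p x u) := fun u => by
    have h0 : mfderiv 𝓘(ℝ, E) 𝓘(ℝ, EN) p x (verticalProj EN g p x u) = 0 :=
      verticalProj_mem EN g p x u
    conv_lhs => rw [← proj_add EN g p x u, map_add, h0, zero_add]
  rw [h u, h v, hp.isometry x _ (horizontalProj_mem EN g p x u) _ (horizontalProj_mem EN g p x v),
    squashedInner_apply, inner_eq_proj EN g p x u v]
  ring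

theorem contMDiffAt_clm_of_apply {G : Type*} [NormedAddCommGroup G] [NormedSpace ℝ G]
    {f : M → E →L[ℝ] G} {x : M}
    (h : ∀ v, ContMDiffAt 𝓘(ℝ, E) 𝓘(ℝ, G) ∞ (fun m => f m v) x) :
    ContMDiffAt 𝓘(ℝ, E) 𝓘(ℝ, E →L[ℝ] G) ∞ f x := by
  let b := Module.finBasis ℝ E
  have e : f = fun m => ∑ i, ContinuousLinearMap.smulRightL ℝ E G
      (LinearMap.toContinuousLinearMap (b.coord i)) (f m (b i)) := by
    funext m
    ext v
    conv_lhs => rw [← b.sum_repr v, map_sum]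
    simp
  rw [e]
  refine ContMDiffAt.sum fun i _ => ?_
  exact (ContinuousLinearMap.contMDiff _).contMDiffAt.comp x (h (b i))

theorem contMDiff_squashedInner {g : RiemMetric E M} {gN : RiemMetric EN N} {p : M → N}
    (hp : IsRiemannianSubmersion g gN p) :
    ContMDiff 𝓘(ℝ, E) (𝓘(ℝ, E).prod 𝓘(ℝ, E →L[ℝ] E →L[ℝ] ℝ)) ∞
      (fun x => TotalSpace.mk' (E →L[ℝ] E →L[ℝ] ℝ)
        (E := fun x : M => TangentSpace 𝓘(ℝ, E) x →L[ℝ] TangentSpace 𝓘(ℝ, E) x →L[ℝ] ℝ)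
        x (squashedInner EN g p x)) := by
  intro x₀
  rw [contMDiffAt_hom_bundle]
  refine ⟨contMDiffAt_id, ?_⟩
  refine contMDiffAt_clm_of_apply fun v => contMDiffAt_clm_of_apply fun w => ?_
  let e := trivializationAt E (fun x : M => TangentSpace 𝓘(ℝ, E) x) x₀
  have he : x₀ ∈ e.baseSet := mem_baseSet_trivializationAt' x₀
  have hev : ∀ v : E, ContMDiffAt 𝓘(ℝ, E) (𝓘(ℝ, E).prod 𝓘(ℝ, E)) ∞
      (fun m => TotalSpace.mk' E (E := fun x : M => TangentSpace 𝓘(ℝ, E) x) m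
        (e.symm m v)) x₀ := by
    intro v
    rw [Trivialization.contMDiffAt_section_iff (IB := 𝓘(ℝ, E)) e he]
    refine (contMDiffAt_const (c := v)).congr_of_eventuallyEq ?_
    filter_upwards [e.open_baseSet.mem_nhds he] with m hm
    rw [e.mk_symm hm, e.apply_symm_apply (e.mem_target.2 hm)]
  have h1 : ContMDiffAt 𝓘(ℝ, E) 𝓘(ℝ, ℝ) ∞
      (fun m => squashedInner EN g p m (e.symm m v) (e.symm m w)) x₀ := by
    have hT : ∀ v : E, ContMDiffAt 𝓘(ℝ, E) (𝓘(ℝ, EN).prod 𝓘(ℝ, EN)) ∞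
        (fun m => TotalSpace.mk' EN (E := fun x : N => TangentSpace 𝓘(ℝ, EN) x) (p m)
          (mfderiv 𝓘(ℝ, E) 𝓘(ℝ, EN) p m (e.symm m v))) x₀ := fun v =>
      ((hp.smooth.contMDiff_tangentMap (m := ∞) (by simp)).contMDiffAt).comp x₀ (hev v)
    simp only [squashedInner_eq hp]
    refine ContMDiffAt.add (contMDiffAt_const.mul ?_) (contMDiffAt_const.mul ?_)
    · let _ : RiemannianBundle (fun x : M => TangentSpace 𝓘(ℝ, E) x) := ⟨g.toRiemannianMetric⟩
      exact ContMDiffAt.inner_bundle (F := E) (E := fun x : M => TangentSpace 𝓘(ℝ, E) x)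
        (hev v) (hev w)
    · let _ : RiemannianBundle (fun x : N => TangentSpace 𝓘(ℝ, EN) x) := ⟨gN.toRiemannianMetric⟩
      exact ContMDiffAt.inner_bundle (F := EN) (E := fun x : N => TangentSpace 𝓘(ℝ, EN) x)
        (hT v) (hT w)
  refine h1.congr_of_eventuallyEq ?_
  filter_upwards [e.open_baseSet.mem_nhds he] with m hm
  have hm' : m ∈ (trivializationAt (E →L[ℝ] ℝ)
      (fun b : M => TangentSpace 𝓘(ℝ, E) b →L[ℝ] ℝ) x₀).baseSet := by
    simpa [hom_trivializationAt_baseSet, e] using hm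
  rw [ContinuousLinearMap.inCoordinates_eq hm hm']
  simp [hom_trivializationAt_apply, ContinuousLinearMap.inCoordinates, e]
  exact congrArg _ (Trivialization.symmL_apply _ hm w)

/-- The Riemannian metric which is `g / 2` on vertical vectors and `g` on horizontal vectors,
with vertical and horizontal vectors orthogonal. -/
def squashedMetric (g : RiemMetric E M) (gN : RiemMetric EN N) (p : M → N)
    (hp : IsRiemannianSubmersion g gN p) : RiemMetric E M where
  inner := squashedInner EN g p
  symm x u v := by
    simp only [squashedInner_apply, g.symm x (verticalProj EN g p x u),
      g.symm x (horizontalProj EN g p x u)]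
  pos x u hu := by
    have h1 := half_inner_le_squashedInner EN g p x u
    have h2 := g.pos x u hu
    linarith
  isVonNBounded x := by
    have h : Bornology.IsVonNBounded ℝ ((fun v : TangentSpace 𝓘(ℝ, E) x => (2 : ℝ) • v) ''
        {v : TangentSpace 𝓘(ℝ, E) x | g.inner x v v < 1}) :=
      (g.isVonNBounded x).image ((2 : ℝ) • ContinuousLinearMap.id ℝ (TangentSpace 𝓘(ℝ, E) x))
    refine Bornology.IsVonNBounded.subset ?_ h
    intro v hv
    refine ⟨(1 / 2 : ℝ) • v, ?_, by simp [smul_smul]⟩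
    have h1 := half_inner_le_squashedInner EN g p x v
    have hv' : squashedInner EN g p x v v < 1 := hv
    simp only [Set.mem_ofPred_eq, map_smul, smul_apply, smul_eq_mul]
    linarith
  contMDiff := contMDiff_squashedInner hp

/-- The fibers of `p` are totally geodesic: their second fundamental form, the horizontal part of
`∇_u W` for vertical `u` and `W`, vanishes. -/
def HasTotallyGeodesicFibers (EN : Type*) [NormedAddCommGroup EN] [NormedSpace ℝ EN]
    [ChartedSpace EN N] (g : RiemMetric E M) (p : M → N) : Prop :=
  ∀ (x : M) (W : Π y : M, TangentSpace 𝓘(ℝ, E) y), MDiffAt (T% W) x →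
    (∀ y, W y ∈ verticalSpace E EN p y) →
    ∀ u ∈ verticalSpace E EN p x, leviCivita g W x u ∈ verticalSpace E EN p x

/-- The almost complex structure which is `-J` on vertical vectors and `J` on horizontal
vectors. -/
def reversedJ (EN : Type*) [NormedAddCommGroup EN] [NormedSpace ℝ EN] [FiniteDimensional ℝ EN]
    [ChartedSpace EN N] [IsManifold 𝓘(ℝ, EN) ∞ N] (g : RiemMetric E M) (p : M → N)
    (J : EndField E M) : EndField E M :=
  fun x => (J x).comp (horizontalProj EN g p x) - (J x).comp (verticalProj EN g p x)

end

/-! Write 𝒱 for the vertical projection, H for 1 - 𝒱, and S v u = (∇_u 𝒱) v. All the geometry of the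
submersion enters through a few laws for S, collected in `ProjDerivLaws`. Differentiating 𝒱² = 𝒱
shows that S exchanges vertical and horizontal vectors in its first slot; since 𝒱 is symmetric and
∇g = 0, S is self-adjoint in that slot. Totally geodesic fibers give S v U = 0 for vertical U. The
submersion property gives g(∇_u W, u) = 0 for W vertical and u horizontal
(`inner_leviCivita_vertical`), hence S is skew on horizontal pairs. Finally ∇J = 0 and [J, 𝒱] = 0
make S linear over J in the first slot; skewness and adjointness turn this into S W (J u) = -J (S W
u) for vertical W (`apply_proj_J`).

The rest is algebra. The Levi-Civita connection of ĝ = g - ½ g(𝒱·,·) is ∇ + D with D v u = -½ (S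
(𝒱v) u + S (𝒱u) v). As Ĵ = J(1 - 2𝒱), this gives (∇̂_u Ĵ) Y = J(-2 S Y u + S (𝒱Y) u + S (𝒱u) Y),
which for u = Y = X is -2 J (S (HX) X) = 0 by skewness. In the canonical connection the D terms
cancel, leaving ∇_u Y + S (Y - 2𝒱Y) u, that is 𝒱∇_u(𝒱Y) + H∇_u(HY), so both distributions are
parallel.

For the holonomy, the forms g(𝒱·,·) and g(H·,·) are parallel for this connection, hence constant
along parallel fields. Their null vectors are the horizontal and the vertical vectors, so every
parallel transport preserves both; no uniqueness of parallel transport is needed. -/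

noncomputable section

variable {E : Type*} [NormedAddCommGroup E] [NormedSpace ℝ E] [FiniteDimensional ℝ E]
  {M : Type*} [TopologicalSpace M] [ChartedSpace E M] [IsManifold 𝓘(ℝ, E) ∞ M]
  {EN : Type*} [NormedAddCommGroup EN] [NormedSpace ℝ EN] [FiniteDimensional ℝ EN]
  {N : Type*} [TopologicalSpace N] [ChartedSpace EN N] [IsManifold 𝓘(ℝ, EN) ∞ N]

/-! ### Fields of endomorphisms and of bilinear forms in coordinates -/

/-- A field of bilinear forms on the tangent spaces of `M`. -/
abbrev BilinField (E : Type*) [NormedAddCommGroup E] [NormedSpace ℝ E]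
    (M : Type*) [TopologicalSpace M] [ChartedSpace E M] :=
  Π x : M, TangentSpace 𝓘(ℝ, E) x →L[ℝ] TangentSpace 𝓘(ℝ, E) x →L[ℝ] ℝ

/-- Smoothness of a field of endomorphisms at a point. -/
def SmoothEndAt (A : EndField E M) (x : M) : Prop :=
  ContMDiffAt 𝓘(ℝ, E) (𝓘(ℝ, E).prod 𝓘(ℝ, E →L[ℝ] E)) ∞
    (fun x => TotalSpace.mk' (E →L[ℝ] E)
      (E := fun x : M => TangentSpace 𝓘(ℝ, E) x →L[ℝ] TangentSpace 𝓘(ℝ, E) x) x (A x)) x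

/-- Smoothness of a field of bilinear forms at a point. -/
def SmoothBilinAt (B : BilinField E M) (x : M) : Prop :=
  ContMDiffAt 𝓘(ℝ, E) (𝓘(ℝ, E).prod 𝓘(ℝ, E →L[ℝ] E →L[ℝ] ℝ)) ∞
    (fun x => TotalSpace.mk' (E →L[ℝ] E →L[ℝ] ℝ)
      (E := fun x : M => TangentSpace 𝓘(ℝ, E) x →L[ℝ] TangentSpace 𝓘(ℝ, E) x →L[ℝ] ℝ) x (B x)) x

/-- The bilinear form `B m` in the trivialization of the tangent bundle centered at `x₀`. -/
def bilinCoord (B : BilinField E M) (x₀ m : M) : E →L[ℝ] E →L[ℝ] ℝ :=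
  ContinuousLinearMap.inCoordinates E (fun x : M => TangentSpace 𝓘(ℝ, E) x) (E →L[ℝ] ℝ)
    (fun x : M => TangentSpace 𝓘(ℝ, E) x →L[ℝ] ℝ) x₀ m x₀ m (B m)

/-- The endomorphism `A m` in the trivialization of the tangent bundle centered at `x₀`. -/
def endCoord (A : EndField E M) (x₀ m : M) : E →L[ℝ] E :=
  ContinuousLinearMap.inCoordinates E (fun x : M => TangentSpace 𝓘(ℝ, E) x) E
    (fun x : M => TangentSpace 𝓘(ℝ, E) x) x₀ m x₀ m (A m)

theorem smoothBilinAt_iff {B : BilinField E M} {x : M} :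
    SmoothBilinAt B x ↔ ContMDiffAt 𝓘(ℝ, E) 𝓘(ℝ, E →L[ℝ] E →L[ℝ] ℝ) ∞ (bilinCoord B x) x := by
  rw [SmoothBilinAt, contMDiffAt_hom_bundle]
  exact and_iff_right contMDiffAt_id

theorem smoothEndAt_iff {A : EndField E M} {x : M} :
    SmoothEndAt A x ↔ ContMDiffAt 𝓘(ℝ, E) 𝓘(ℝ, E →L[ℝ] E) ∞ (endCoord A x) x := by
  rw [SmoothEndAt, contMDiffAt_hom_bundle]
  exact and_iff_right contMDiffAt_id

theorem bilinCoord_apply (B : BilinField E M) {x₀ m : M}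
    (hm : m ∈ (trivializationAt E (fun x : M => TangentSpace 𝓘(ℝ, E) x) x₀).baseSet) (v w : E) :
    bilinCoord B x₀ m v w =
      B m ((trivializationAt E (fun x : M => TangentSpace 𝓘(ℝ, E) x) x₀).symm m v)
        ((trivializationAt E (fun x : M => TangentSpace 𝓘(ℝ, E) x) x₀).symm m w) := by
  have hm' : m ∈ (trivializationAt (E →L[ℝ] ℝ)
      (fun b : M => TangentSpace 𝓘(ℝ, E) b →L[ℝ] ℝ) x₀).baseSet := by
    simpa [hom_trivializationAt_baseSet] using hm
  rw [bilinCoord, ContinuousLinearMap.inCoordinates_eq hm hm']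
  simp [hom_trivializationAt_apply, ContinuousLinearMap.inCoordinates]
  exact congrArg _ (Trivialization.symmL_apply _ hm w)

theorem endCoord_apply (A : EndField E M) {x₀ m : M}
    (hm : m ∈ (trivializationAt E (fun x : M => TangentSpace 𝓘(ℝ, E) x) x₀).baseSet) (v : E) :
    endCoord A x₀ m v = (trivializationAt E (fun x : M => TangentSpace 𝓘(ℝ, E) x) x₀
      ⟨m, A m ((trivializationAt E (fun x : M => TangentSpace 𝓘(ℝ, E) x) x₀).symm m v)⟩).2 := by
  rw [endCoord, ContinuousLinearMap.inCoordinates_eq hm hm]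
  simp

theorem symm_endCoord_apply (A : EndField E M) {x₀ m : M}
    (hm : m ∈ (trivializationAt E (fun x : M => TangentSpace 𝓘(ℝ, E) x) x₀).baseSet) (v : E) :
    (trivializationAt E (fun x : M => TangentSpace 𝓘(ℝ, E) x) x₀).symm m (endCoord A x₀ m v) =
      A m ((trivializationAt E (fun x : M => TangentSpace 𝓘(ℝ, E) x) x₀).symm m v) := by
  rw [endCoord_apply A hm]
  exact Trivialization.symm_apply_apply_mk _ hm _

theorem SmoothEndAt.comp {A B : EndField E M} {x : M} (hA : SmoothEndAt A x)
    (hB : SmoothEndAt B x) : SmoothEndAt (fun y => (A y).comp (B y)) x := by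
  rw [smoothEndAt_iff] at *
  refine (hA.clm_comp hB).congr_of_eventuallyEq ?_
  filter_upwards [(trivializationAt E (fun x : M => TangentSpace 𝓘(ℝ, E) x) x).open_baseSet.mem_nhds
    (mem_baseSet_trivializationAt' x)] with m hm
  ext v
  rw [endCoord_apply _ hm]
  change _ = endCoord A x m (endCoord B x m v)
  rw [endCoord_apply A hm, symm_endCoord_apply B hm]
  rfl

theorem SmoothEndAt.sub {A B : EndField E M} {x : M} (hA : SmoothEndAt A x)
    (hB : SmoothEndAt B x) : SmoothEndAt (fun y => A y - B y) x :=
  ContMDiffAt.sub_section (V := fun x : M => TangentSpace 𝓘(ℝ, E) x →L[ℝ] TangentSpace 𝓘(ℝ, E) x)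
    hA hB

theorem SmoothEndAt.mdiffAt_apply {A : EndField E M} {x : M} (hA : SmoothEndAt A x)
    {Y : Π y : M, TangentSpace 𝓘(ℝ, E) y} (hY : MDiffAt (T% Y) x) :
    MDiffAt (T% (fun y => A y (Y y))) x :=
  MDifferentiableAt.clm_bundle_apply (b := fun y => y) (hA.mdifferentiableAt (by simp)) hY

theorem RiemMetric.smoothBilinAt (g : RiemMetric E M) (x : M) :
    SmoothBilinAt (fun y => g.inner y) x := g.contMDiff x

theorem SmoothBilinAt.sub {A B : BilinField E M} {x : M} (hA : SmoothBilinAt A x)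
    (hB : SmoothBilinAt B x) : SmoothBilinAt (fun y => A y - B y) x := by
  rw [smoothBilinAt_iff] at *
  refine (hA.sub hB).congr_of_eventuallyEq ?_
  filter_upwards [(trivializationAt E (fun x : M => TangentSpace 𝓘(ℝ, E) x) x).open_baseSet.mem_nhds
    (mem_baseSet_trivializationAt' x)] with m hm
  ext v w
  change _ = bilinCoord A x m v w - bilinCoord B x m v w
  simp only [bilinCoord_apply _ hm, sub_apply]

theorem SmoothBilinAt.const_smul {A : BilinField E M} {x : M} (hA : SmoothBilinAt A x) (c : ℝ) :
    SmoothBilinAt (fun y => c • A y) x := by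
  rw [smoothBilinAt_iff] at *
  refine ((c • ContinuousLinearMap.id ℝ (E →L[ℝ] E →L[ℝ] ℝ)).contMDiff.contMDiffAt.comp x
    hA).congr_of_eventuallyEq ?_
  filter_upwards [(trivializationAt E (fun x : M => TangentSpace 𝓘(ℝ, E) x) x).open_baseSet.mem_nhds
    (mem_baseSet_trivializationAt' x)] with m hm
  ext v w
  change _ = c • bilinCoord A x m v w
  simp only [bilinCoord_apply _ hm, smul_apply]

/-- Positive definiteness makes the Gram operator E → E* injective, and the two spaces have the same
dimension. This allows smooth dependence to be transferred from a form to the endomorphism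
representing it. -/
theorem bilinCoord_isInvertible (g : RiemMetric E M) {x₀ m : M}
    (hm : m ∈ (trivializationAt E (fun x : M => TangentSpace 𝓘(ℝ, E) x) x₀).baseSet) :
    (bilinCoord (fun y => g.inner y) x₀ m).IsInvertible := by
  have hinj : Function.Injective (bilinCoord (fun y => g.inner y) x₀ m).toLinearMap := by
    rw [← LinearMap.ker_eq_bot, LinearMap.ker_eq_bot']
    intro v hv
    have h0 := congr($hv v)
    change bilinCoord (fun y => g.inner y) x₀ m v v = 0 at h0
    rw [bilinCoord_apply _ hm] at h0
    have h1 : (trivializationAt E (fun x : M => TangentSpace 𝓘(ℝ, E) x) x₀).symm m v = 0 := by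
      by_contra hne
      exact (g.pos m _ hne).ne' h0
    have h2 := Trivialization.apply_mk_symm
      (trivializationAt E (fun x : M => TangentSpace 𝓘(ℝ, E) x) x₀) hm v
    rw [h1] at h2
    refine (congrArg Prod.snd h2).symm.trans ?_
    rw [← Trivialization.continuousLinearMapAt_apply_of_mem (R := ℝ) _ hm]
    exact map_zero (Trivialization.continuousLinearMapAt ℝ
      (trivializationAt E (fun x : M => TangentSpace 𝓘(ℝ, E) x) x₀) m)
  have hfin : Module.finrank ℝ E = Module.finrank ℝ (E →L[ℝ] ℝ) := by
    rw [← (LinearMap.toContinuousLinearMap (𝕜 := ℝ) (E := E) (F' := ℝ)).finrank_eq]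
    exact (Subspace.dual_finrank_eq).symm
  exact ⟨(LinearEquiv.ofInjectiveOfFinrankEq _ hinj hfin).toContinuousLinearEquiv, rfl⟩

/-- A field of endomorphisms that represents a smooth field of bilinear forms with respect to a
smooth metric is smooth. -/
theorem smoothEndAt_of_inner (g : RiemMetric E M) {A : EndField E M} {B : BilinField E M} {x : M}
    (hB : SmoothBilinAt B x) (h : ∀ y u v, g.inner y (A y u) v = B y u v) : SmoothEndAt A x := by
  rw [smoothEndAt_iff]
  rw [smoothBilinAt_iff] at hB
  have hG := smoothBilinAt_iff.1 (g.smoothBilinAt x)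
  have hx := mem_baseSet_trivializationAt' (F := E) (E := fun x : M => TangentSpace 𝓘(ℝ, E) x) x
  obtain ⟨L, hL⟩ := bilinCoord_isInvertible g hx
  -- In coordinates the endomorphism is G⁻¹B, with G the Gram operator of g; inversion of operators
  -- is smooth near an invertible one.
  have hinv : ContMDiffAt 𝓘(ℝ, E) 𝓘(ℝ, (E →L[ℝ] ℝ) →L[ℝ] E) ∞
      (fun m => (bilinCoord (fun y => g.inner y) x m).inverse) x := by
    refine ContMDiffAt.comp x (g := ContinuousLinearMap.inverse) ?_ hG
    rw [← hL]
    exact (contDiffAt_map_inverse L).contMDiffAt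
  refine (hinv.clm_comp hB).congr_of_eventuallyEq ?_
  filter_upwards [(trivializationAt E (fun x : M => TangentSpace 𝓘(ℝ, E) x) x).open_baseSet.mem_nhds
    hx] with m hm
  have h1 : (bilinCoord (fun y => g.inner y) x m).comp (endCoord A x m) = bilinCoord B x m := by
    ext v w
    rw [ContinuousLinearMap.comp_apply, bilinCoord_apply _ hm, symm_endCoord_apply A hm, h,
      bilinCoord_apply _ hm]
  rw [← h1, ← ContinuousLinearMap.comp_assoc, (bilinCoord_isInvertible g hm).inverse_comp_self]
  rfl

/-! ### Vertical and horizontal projections -/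

theorem verticalProj_of_mem {g : RiemMetric E M} {p : M → N} {x : M} {u : TangentSpace 𝓘(ℝ, E) x}
    (hu : u ∈ verticalSpace E EN p x) : verticalProj EN g p x u = u :=
  Submodule.projection_apply_of_mem_left (isCompl_vertical_horizontal EN g p x) hu

theorem verticalProj_of_mem_horizontal {g : RiemMetric E M} {p : M → N} {x : M}
    {u : TangentSpace 𝓘(ℝ, E) x} (hu : u ∈ horizontalSpace EN g p x) :
    verticalProj EN g p x u = 0 :=
  (Submodule.projection_apply_eq_zero_iff _).2 hu

theorem verticalProj_comm_of_preserves {g : RiemMetric E M} {p : M → N} {x : M}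
    {L : TangentSpace 𝓘(ℝ, E) x →L[ℝ] TangentSpace 𝓘(ℝ, E) x}
    (hV : ∀ u ∈ verticalSpace E EN p x, L u ∈ verticalSpace E EN p x)
    (hH : ∀ u ∈ horizontalSpace EN g p x, L u ∈ horizontalSpace EN g p x)
    (u : TangentSpace 𝓘(ℝ, E) x) :
    verticalProj EN g p x (L u) = L (verticalProj EN g p x u) := by
  conv_lhs => rw [← proj_add EN g p x u, map_add, map_add]
  rw [verticalProj_of_mem (hV _ (verticalProj_mem EN g p x u)),
    verticalProj_of_mem_horizontal (hH _ (horizontalProj_mem EN g p x u)), add_zero]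

variable (EN) in
theorem inner_verticalProj_left (g : RiemMetric E M) (p : M → N) (x : M)
    (u v : TangentSpace 𝓘(ℝ, E) x) :
    g.inner x (verticalProj EN g p x u) v =
      g.inner x (verticalProj EN g p x u) (verticalProj EN g p x v) := by
  conv_lhs => rw [← proj_add EN g p x v, map_add]
  rw [horizontalProj_mem EN g p x v _ (verticalProj_mem EN g p x u), add_zero]

variable (EN) in
theorem inner_verticalProj_comm (g : RiemMetric E M) (p : M → N) (x : M)
    (u v : TangentSpace 𝓘(ℝ, E) x) :
    g.inner x (verticalProj EN g p x u) v = g.inner x u (verticalProj EN g p x v) := by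
  rw [inner_verticalProj_left, g.symm x u, inner_verticalProj_left EN g p x v u, g.symm]

theorem squashedInner_eq_sub (g : RiemMetric E M) (p : M → N) (x : M)
    (u v : TangentSpace 𝓘(ℝ, E) x) :
    squashedInner EN g p x u v =
      g.inner x u v - (1 / 2) * g.inner x (verticalProj EN g p x u) v := by
  rw [squashedInner_apply, inner_eq_proj EN g p x u v, inner_verticalProj_left EN g p x u v]
  ring

/-- The form g(𝒱u, v) equals 2(g - ĝ)(u, v), and ĝ = ½ g + ½ p^*g_N is already known to be smooth;
representing this form by g recovers 𝒱. -/
theorem IsRiemannianSubmersion.smoothEndAt_verticalProj {g : RiemMetric E M} {gN : RiemMetric EN N}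
    {p : M → N} (hp : IsRiemannianSubmersion g gN p) (x : M) :
    SmoothEndAt (fun y => verticalProj EN g p y) x := by
  refine smoothEndAt_of_inner g
    (B := fun y => (2 : ℝ) • (g.inner y - squashedInner EN g p y)) ?_ ?_
  · exact ((g.smoothBilinAt x).sub (contMDiff_squashedInner hp x)).const_smul 2
  · intro y u v
    simp only [smul_apply, sub_apply, squashedInner_eq_sub, smul_eq_mul]
    ring

theorem smoothEndAt_id (x : M) :
    SmoothEndAt (fun y => ContinuousLinearMap.id ℝ (TangentSpace 𝓘(ℝ, E) y)) x := by
  rw [smoothEndAt_iff]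
  refine (contMDiffAt_const (c := ContinuousLinearMap.id ℝ E)).congr_of_eventuallyEq ?_
  filter_upwards [(trivializationAt E (fun x : M => TangentSpace 𝓘(ℝ, E) x) x).open_baseSet.mem_nhds
    (mem_baseSet_trivializationAt' x)] with m hm
  ext v
  rw [endCoord_apply _ hm]
  exact congrArg Prod.snd (Trivialization.apply_mk_symm _ hm v)

theorem IsRiemannianSubmersion.smoothEndAt_horizontalProj {g : RiemMetric E M}
    {gN : RiemMetric EN N} {p : M → N} (hp : IsRiemannianSubmersion g gN p) (x : M) :
    SmoothEndAt (fun y => horizontalProj EN g p y) x :=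
  (smoothEndAt_id x).sub (hp.smoothEndAt_verticalProj x)

/-! ### Derivatives of bilinear forms along maps -/

theorem HasMFDerivWithinAt.clm_apply_vec {F G K : Type*} [NormedAddCommGroup F] [NormedSpace ℝ F]
    [NormedAddCommGroup G] [NormedSpace ℝ G] [NormedAddCommGroup K] [NormedSpace ℝ K]
    {X : Type*} [TopologicalSpace X] [ChartedSpace F X] {c : X → G →L[ℝ] K} {u : X → G}
    {s : Set X} {x : X} {c' : F →L[ℝ] G →L[ℝ] K} {u' : F →L[ℝ] G}
    (hc : HasMFDerivWithinAt 𝓘(ℝ, F) 𝓘(ℝ, G →L[ℝ] K) c s x c')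
    (hu : HasMFDerivWithinAt 𝓘(ℝ, F) 𝓘(ℝ, G) u s x u') :
    HasMFDerivWithinAt 𝓘(ℝ, F) 𝓘(ℝ, K) (fun y => c y (u y)) s x
      ((c x).comp u' + c'.flip (u x) : F →L[ℝ] K) := by
  refine ⟨hc.1.clm_apply hu.1, ?_⟩
  -- The targets are vector spaces, whose charts are the identity, so only the chart of the domain
  -- intervenes and the ordinary product rule applies.
  have h1 : HasFDerivWithinAt (fun z => c ((extChartAt 𝓘(ℝ, F) x).symm z)) c'
      ((extChartAt 𝓘(ℝ, F) x).symm ⁻¹' s ∩ Set.range 𝓘(ℝ, F)) (extChartAt 𝓘(ℝ, F) x x) := hc.2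
  have h2 : HasFDerivWithinAt (fun z => u ((extChartAt 𝓘(ℝ, F) x).symm z)) u'
      ((extChartAt 𝓘(ℝ, F) x).symm ⁻¹' s ∩ Set.range 𝓘(ℝ, F)) (extChartAt 𝓘(ℝ, F) x x) := hu.2
  have h3 := h1.clm_apply h2
  simp only [extChartAt_to_inv] at h3
  exact h3

/-- The derivative of a field of bilinear forms along a map `b`, applied to two vector fields
along `b` that are given by their coordinates in the trivialization centered at `b x`. -/
theorem SmoothBilinAt.hasMFDerivWithinAt_along {F : Type*} [NormedAddCommGroup F]
    [NormedSpace ℝ F] {X : Type*} [TopologicalSpace X] [ChartedSpace F X] {B : BilinField E M}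
    {b : X → M} {s : Set X} {x : X} (hB : SmoothBilinAt B (b x))
    {b' : F →L[ℝ] TangentSpace 𝓘(ℝ, E) (b x)}
    (hb : HasMFDerivWithinAt 𝓘(ℝ, F) 𝓘(ℝ, E) b s x b')
    (v w : Π y : X, TangentSpace 𝓘(ℝ, E) (b y)) {v' w' : F →L[ℝ] E}
    (hv : HasMFDerivWithinAt 𝓘(ℝ, F) 𝓘(ℝ, E) (fun y => (trivializationAt E
      (fun x : M => TangentSpace 𝓘(ℝ, E) x) (b x) ⟨b y, v y⟩).2) s x v')
    (hw : HasMFDerivWithinAt 𝓘(ℝ, F) 𝓘(ℝ, E) (fun y => (trivializationAt E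
      (fun x : M => TangentSpace 𝓘(ℝ, E) x) (b x) ⟨b y, w y⟩).2) s x w') :
    ∃ f' : F →L[ℝ] ℝ,
      HasMFDerivWithinAt 𝓘(ℝ, F) 𝓘(ℝ, ℝ) (fun y => B (b y) (v y) (w y)) (insert x s) x f' ∧
      ∀ u, f' u = d% (fun q => B q (extend E (v x) q) (extend E (w x) q)) (b x) (b' u)
        + B (b x) ((trivializationAt E (fun x : M => TangentSpace 𝓘(ℝ, E) x) (b x)).symm (b x)
            (v' u)) (w x)
        + B (b x) (v x) ((trivializationAt E (fun x : M => TangentSpace 𝓘(ℝ, E) x) (b x)).symm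
            (b x) (w' u)) := by
  set e := trivializationAt E (fun x : M => TangentSpace 𝓘(ℝ, E) x) (b x) with he
  have hx : b x ∈ e.baseSet := mem_baseSet_trivializationAt' (b x)
  have hCd := (smoothBilinAt_iff.1 hB).mdifferentiableAt (by simp)
  set C' : E →L[ℝ] E →L[ℝ] E →L[ℝ] ℝ :=
    mfderiv 𝓘(ℝ, E) 𝓘(ℝ, E →L[ℝ] E →L[ℝ] ℝ) (bilinCoord B (b x)) (b x) with hC'
  have hC : HasMFDerivAt 𝓘(ℝ, E) 𝓘(ℝ, E →L[ℝ] E →L[ℝ] ℝ) (bilinCoord B (b x)) (b x) C' :=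
    hCd.hasMFDerivAt
  -- In the frame centered at `b x`, the expression is a matrix-valued function composed with b and
  -- applied to two coordinate vectors; the product rule is used twice.
  have hCb : HasMFDerivWithinAt 𝓘(ℝ, F) 𝓘(ℝ, E →L[ℝ] E →L[ℝ] ℝ)
      (fun y => bilinCoord B (b x) (b y)) s x (C'.comp b' : F →L[ℝ] E →L[ℝ] E →L[ℝ] ℝ) :=
    hC.comp_hasMFDerivWithinAt x hb
  have h1 := (hCb.clm_apply_vec hv).clm_apply_vec hw
  have hloc : ∀ q ∈ e.baseSet, ∀ v w : TangentSpace 𝓘(ℝ, E) q,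
      B q v w = bilinCoord B (b x) q (e ⟨q, v⟩).2 (e ⟨q, w⟩).2 := by
    intro q hq v w
    rw [bilinCoord_apply B hq, e.symm_apply_apply_mk hq, e.symm_apply_apply_mk hq]
  refine ⟨_, h1.insert.congr_of_eventuallyEq ?_ ?_, ?_⟩
  · have := hb.insert.1 (e.open_baseSet.mem_nhds hx)
    filter_upwards [this] with y hy
    exact hloc _ hy _ _
  · exact hloc _ hx _ _
  · intro u
    -- The fields `extend E (v x)` and `extend E (w x)` have constant coordinates in this frame, so
    -- only the derivative C' of the matrix of B survives.
    have hD : HasMFDerivAt 𝓘(ℝ, E) 𝓘(ℝ, ℝ)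
        (fun q => B q (extend E (v x) q) (extend E (w x) q)) (b x)
        ((C'.flip (e ⟨b x, v x⟩).2).flip (e ⟨b x, w x⟩).2 : E →L[ℝ] ℝ) := by
      have h2 : HasMFDerivAt 𝓘(ℝ, E) 𝓘(ℝ, ℝ)
          (fun q => bilinCoord B (b x) q (e ⟨b x, v x⟩).2 (e ⟨b x, w x⟩).2) (b x)
          ((C'.flip (e ⟨b x, v x⟩).2).flip (e ⟨b x, w x⟩).2 : E →L[ℝ] ℝ) := by
        have hc : ∀ a : E, HasMFDerivWithinAt 𝓘(ℝ, E) 𝓘(ℝ, E) (fun _ : M => a) Set.univ (b x)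
            (0 : E →L[ℝ] E) := fun a => hasMFDerivWithinAt_const a _ _
        have h3 := ((hasMFDerivWithinAt_univ.2 hC).clm_apply_vec (c' := C')
          (hc (e ⟨b x, v x⟩).2)).clm_apply_vec (hc (e ⟨b x, w x⟩).2)
        simp only [ContinuousLinearMap.comp_zero, zero_add] at h3
        exact hasMFDerivWithinAt_univ.1 h3
      refine h2.congr_of_eventuallyEq ?_
      filter_upwards [e.open_baseSet.mem_nhds hx] with q hq
      rw [bilinCoord_apply B hq]
      rfl
    have h4 : d% (fun q => B q (extend E (v x) q) (extend E (w x) q)) (b x) (b' u) =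
        C' (b' u) (e ⟨b x, v x⟩).2 (e ⟨b x, w x⟩).2 := by
      rw [mvfderiv, hD.mfderiv]
      rfl
    have h5 : ∀ a : E, (e ⟨b x, e.symm (b x) a⟩).2 = a := fun a =>
      congrArg Prod.snd (e.apply_mk_symm hx a)
    rw [h4, hloc _ hx, hloc _ hx, h5, h5]
    change bilinCoord B (b x) (b x) (e ⟨b x, v x⟩).2 (w' u) +
      (bilinCoord B (b x) (b x) (v' u) (e ⟨b x, w x⟩).2 +
      C' (b' u) (e ⟨b x, v x⟩).2 (e ⟨b x, w x⟩).2) = _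
    ring
/-! ### The Lie bracket as a commutator of derivations -/

theorem mpullbackWithin_extChartAt_symm_apply (X : Π y : M, TangentSpace 𝓘(ℝ, E) y) {x y : M}
    (hy : y ∈ (extChartAt 𝓘(ℝ, E) x).source) :
    mpullbackWithin 𝓘(ℝ, E) 𝓘(ℝ, E) (extChartAt 𝓘(ℝ, E) x).symm X (Set.range 𝓘(ℝ, E))
      (extChartAt 𝓘(ℝ, E) x y) = mfderiv 𝓘(ℝ, E) 𝓘(ℝ, E) (extChartAt 𝓘(ℝ, E) x) y (X y) := by
  have : IsManifold 𝓘(ℝ, E) 1 M := .of_le (n := ∞) (by simp)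
  have hinv := isInvertible_mfderivWithin_extChartAt_symm (I := 𝓘(ℝ, E))
    ((extChartAt 𝓘(ℝ, E) x).map_source hy)
  have h1 := mfderivWithin_extChartAt_symm_comp_mfderiv_extChartAt' (I := 𝓘(ℝ, E)) hy
  have h2 : (X ((extChartAt 𝓘(ℝ, E) x).symm (extChartAt 𝓘(ℝ, E) x y)) : E) = X y :=
    congrArg (fun q => (X q : E)) ((extChartAt 𝓘(ℝ, E) x).left_inv hy)
  rw [mpullbackWithin_apply]
  exact hinv.inverse_apply_eq.2 (h2.trans congr($h1 (X y)).symm)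

/-- The Lie bracket acts on functions as the commutator of derivations. -/
theorem mvfderiv_mlieBracket {F : Type*} [NormedAddCommGroup F] [NormedSpace ℝ F] {f : M → F}
    {x : M} (hf : ContMDiffAt 𝓘(ℝ, E) 𝓘(ℝ, F) ∞ f x) {X Y : Π y : M, TangentSpace 𝓘(ℝ, E) y}
    (hX : MDiffAt (T% X) x) (hY : MDiffAt (T% Y) x) :
    d% f x (mlieBracket 𝓘(ℝ, E) X Y x) =
      d% (fun y => d% f y (Y y)) x (X x) - d% (fun y => d% f y (X y)) x (Y x) := by
  have : IsManifold 𝓘(ℝ, E) 1 M := .of_le (n := ∞) (by simp)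
  have : IsManifold 𝓘(ℝ, E) 2 M := .of_le (n := ∞) ENat.LEInfty.out
  set φ := extChartAt 𝓘(ℝ, E) x with hφ
  have hxs : x ∈ φ.source := mem_extChartAt_source x
  let lift (Z : Π y : M, TangentSpace 𝓘(ℝ, E) y) : E → E :=
    mpullbackWithin 𝓘(ℝ, E) 𝓘(ℝ, E) φ.symm Z (Set.range 𝓘(ℝ, E))
  have hlift : ∀ Z : Π y : M, TangentSpace 𝓘(ℝ, E) y, MDiffAt (T% Z) x →
      DifferentiableAt ℝ (lift Z) (φ x) := by
    intro Z hZ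
    have := hZ.mdifferentiableWithinAt
      (s := Set.univ).differentiableWithinAt_mpullbackWithin_vectorField
    rw [Set.preimage_univ, Set.univ_inter, modelWithCornersSelf_coe, Set.range_id] at this
    rw [← differentiableWithinAt_univ]
    simpa only [lift, modelWithCornersSelf_coe, Set.range_id] using this
  let G : E → F := fun z => f (φ.symm z)
  have hG : ContDiffAt ℝ ∞ G (φ x) := by
    have := (contMDiffAt_iff.1 hf).2
    rw [modelWithCornersSelf_coe, Set.range_id, contDiffWithinAt_univ] at this
    exact this
  -- The identity is needed on a neighborhood, because the function y ↦ df(Y) is differentiated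
  -- again below.
  have hderiv : ∀ᶠ y in nhds x, ∀ u : TangentSpace 𝓘(ℝ, E) y,
      d% f y u = fderiv ℝ G (φ y) (mfderiv 𝓘(ℝ, E) 𝓘(ℝ, E) φ y u) := by
    have h1 : ∀ᶠ y in nhds x, DifferentiableAt ℝ G (φ y) :=
      (continuousAt_extChartAt x).eventually
        (((hG.of_le (m := 1) (by simp)).eventually (by simp)).mono fun z hz => hz.differentiableAt (by simp))
    filter_upwards [h1, extChartAt_source_mem_nhds (I := 𝓘(ℝ, E)) x] with y hy hys u
    have h2 : HasMFDerivAt 𝓘(ℝ, E) 𝓘(ℝ, F) (G ∘ φ) y _ :=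
      HasMFDerivAt.comp y hy.hasFDerivAt.hasMFDerivAt
        (mdifferentiableAt_extChartAt (by simpa using hys)).hasMFDerivAt
    have h3 : HasMFDerivAt 𝓘(ℝ, E) 𝓘(ℝ, F) f y _ := h2.congr_of_eventuallyEq (by
      filter_upwards [extChartAt_source_mem_nhds' hys] with q hq
      simp [G, φ.left_inv hq])
    rw [mvfderiv, h3.mfderiv]
    rfl
  -- In the chart, W(Zf) is the Hessian term D²G(W, Z) plus the first-order term DG(D_W Z).
  have key : ∀ Z W : Π y : M, TangentSpace 𝓘(ℝ, E) y, MDiffAt (T% Z) x →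
      d% (fun y => d% f y (Z y)) x (W x) =
        fderiv ℝ (fderiv ℝ G) (φ x) (lift W (φ x)) (lift Z (φ x)) +
          fderiv ℝ G (φ x) (fderiv ℝ (lift Z) (φ x) (lift W (φ x))) := by
    intro Z W hZ
    have hK : HasFDerivAt (fun z => fderiv ℝ G z (lift Z z)) _ (φ x) :=
      ((hG.fderiv_right (m := 1) (by rw [one_add_one_eq_two]; exact ENat.LEInfty.out)).differentiableAt
        (by simp)).hasFDerivAt.clm_apply (hlift Z hZ).hasFDerivAt
    have h2 : HasMFDerivAt 𝓘(ℝ, E) 𝓘(ℝ, F) ((fun z => fderiv ℝ G z (lift Z z)) ∘ φ) x _ :=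
      HasMFDerivAt.comp x hK.hasMFDerivAt
        (mdifferentiableAt_extChartAt (by simp)).hasMFDerivAt
    have h3 : HasMFDerivAt 𝓘(ℝ, E) 𝓘(ℝ, F) (fun y => d% f y (Z y)) x _ :=
      h2.congr_of_eventuallyEq (by
        filter_upwards [hderiv, extChartAt_source_mem_nhds (I := 𝓘(ℝ, E)) x] with y hy hys
        rw [hy]
        exact congrArg _ (mpullbackWithin_extChartAt_symm_apply Z hys).symm)
    have h4 : lift W (φ x) = mfderiv 𝓘(ℝ, E) 𝓘(ℝ, E) φ x (W x) :=
      mpullbackWithin_extChartAt_symm_apply W hxs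
    rw [mvfderiv, h3.mfderiv, h4]
    exact add_comm _ _
  rw [key Y X hY, key X Y hX, hderiv.self_of_nhds]
  -- The manifold bracket is defined as the pullback of the flat bracket by the chart, so the chart
  -- differential undoes that pullback.
  have h5 : mfderiv 𝓘(ℝ, E) 𝓘(ℝ, E) φ x (mlieBracket 𝓘(ℝ, E) X Y x) =
      lieBracket ℝ (lift X) (lift Y) (φ x) := by
    have hinv := isInvertible_mfderiv_extChartAt (I := 𝓘(ℝ, E)) hxs
    have h : lieBracket ℝ (lift X) (lift Y) (φ x) = lieBracketWithin ℝ (lift X) (lift Y)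
        (φ.symm ⁻¹' Set.univ ∩ Set.range 𝓘(ℝ, E)) (φ x) := by simp
    rw [h]
    exact (hinv.inverse_apply_eq.1 rfl).symm
  -- By symmetry of the second derivative the Hessian terms cancel in the commutator.
  have h6 : fderiv ℝ (fderiv ℝ G) (φ x) (lift X (φ x)) (lift Y (φ x)) =
      fderiv ℝ (fderiv ℝ G) (φ x) (lift Y (φ x)) (lift X (φ x)) :=
    hG.isSymmSndFDerivAt (by simpa using ENat.LEInfty.out) _ _
  rw [h5, h6, lieBracket, map_sub]
  abel

/-! ### Vertical fields of a Riemannian submersion -/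

theorem leviCivita_isLeviCivita (g : RiemMetric E M) : IsLeviCivita g (leviCivita g) :=
  (exists_isLeviCivita g).choose_spec

theorem IsLeviCivita.sub_eq_mlieBracket {g : RiemMetric E M} {D : AffineConnection E M}
    (h : IsLeviCivita g D) {X Y : Π y : M, TangentSpace 𝓘(ℝ, E) y} {x : M}
    (hX : MDiffAt (T% X) x) (hY : MDiffAt (T% Y) x) :
    D Y x (X x) - D X x (Y x) = mlieBracket 𝓘(ℝ, E) X Y x :=
  D.torsion_eq_zero_iff.1 h.torsion_eq_zero hX hY

theorem IsRiemannianSubmersion.inner_horizontal {g : RiemMetric E M} {gN : RiemMetric EN N}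
    {p : M → N} (hp : IsRiemannianSubmersion g gN p) {x : M} (u : TangentSpace 𝓘(ℝ, E) x)
    {v : TangentSpace 𝓘(ℝ, E) x} (hv : v ∈ horizontalSpace EN g p x) :
    g.inner x u v = gN.inner (p x) (mfderiv 𝓘(ℝ, E) 𝓘(ℝ, EN) p x u)
      (mfderiv 𝓘(ℝ, E) 𝓘(ℝ, EN) p x v) := by
  have h0 : mfderiv 𝓘(ℝ, E) 𝓘(ℝ, EN) p x (verticalProj EN g p x u) = 0 :=
    verticalProj_mem EN g p x u
  rw [← proj_add EN g p x u, map_add, map_add, h0, zero_add, add_apply,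
    hv _ (verticalProj_mem EN g p x u), zero_add,
    hp.isometry x _ (horizontalProj_mem EN g p x u) _ hv]

/-- The differential of a chart is the trivialization of the tangent bundle. -/
theorem trivializationAt_eq_mfderiv_extChartAt {q₀ q : N} (hq : q ∈ (chartAt EN q₀).source)
    (w : TangentSpace 𝓘(ℝ, EN) q) :
    (trivializationAt EN (fun x : N => TangentSpace 𝓘(ℝ, EN) x) q₀ ⟨q, w⟩).2 =
      mfderiv 𝓘(ℝ, EN) 𝓘(ℝ, EN) (extChartAt 𝓘(ℝ, EN) q₀) q w := by
  have : IsManifold 𝓘(ℝ, EN) 1 N := .of_le (n := ∞) (by simp)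
  rw [← TangentBundle.continuousLinearMapAt_trivializationAt hq]
  exact (Trivialization.continuousLinearMapAt_apply_of_mem (R := ℝ) _ (by simpa using hq)
    w).symm

/-- Composing p with a chart of N turns dp, read in the trivialization, into the derivative of a
vector-valued function, to which the commutator formula for brackets applies. -/
theorem eventually_mvfderiv_extChartAt_comp {p : M → N}
    (hp : ContMDiff 𝓘(ℝ, E) 𝓘(ℝ, EN) ∞ p) (x : M) :
    ∀ᶠ y in nhds x, ∀ u : TangentSpace 𝓘(ℝ, E) y,
      d% (fun y => extChartAt 𝓘(ℝ, EN) (p x) (p y)) y u =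
        (trivializationAt EN (fun x : N => TangentSpace 𝓘(ℝ, EN) x) (p x)
          ⟨p y, mfderiv 𝓘(ℝ, E) 𝓘(ℝ, EN) p y u⟩).2 := by
  have : IsManifold 𝓘(ℝ, EN) 1 N := .of_le (n := ∞) (by simp)
  have hsrc : ∀ᶠ y in nhds x, p y ∈ (chartAt EN (p x)).source :=
    hp.continuous.continuousAt.eventually
      ((chartAt EN (p x)).open_source.mem_nhds (mem_chart_source EN (p x)))
  filter_upwards [hsrc] with y hy u
  have h1 : HasMFDerivAt 𝓘(ℝ, E) 𝓘(ℝ, EN) (extChartAt 𝓘(ℝ, EN) (p x) ∘ p) y _ :=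
    HasMFDerivAt.comp y (mdifferentiableAt_extChartAt hy).hasMFDerivAt
      ((hp y).mdifferentiableAt (by simp)).hasMFDerivAt
  rw [trivializationAt_eq_mfderiv_extChartAt hy, mvfderiv]
  have h2 := h1.mfderiv
  rw [Function.comp_def] at h2
  rw [h2]
  rfl

/-- For a vertical field `W` of a Riemannian submersion, `∇W` is skew on horizontal vectors. -/
theorem IsRiemannianSubmersion.inner_leviCivita_vertical {g : RiemMetric E M}
    {gN : RiemMetric EN N} {p : M → N} (hp : IsRiemannianSubmersion g gN p) {x : M}
    {W : Π y : M, TangentSpace 𝓘(ℝ, E) y} (hW : MDiffAt (T% W) x)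
    (hWv : ∀ y, W y ∈ verticalSpace E EN p y) {u : TangentSpace 𝓘(ℝ, E) x}
    (hu : u ∈ horizontalSpace EN g p x) : g.inner x (leviCivita g W x u) u = 0 := by
  -- A horizontal extension of u suffices; it need not be projectable to N.
  let X : Π y : M, TangentSpace 𝓘(ℝ, E) y := fun y => horizontalProj EN g p y (extend E u y)
  have hX : MDiffAt (T% X) x :=
    (hp.smoothEndAt_horizontalProj x).mdiffAt_apply (mdifferentiableAt_extend ..)
  have hXu : X x = u := by
    have := verticalProj_of_mem_horizontal hu
    simp [X, horizontalProj, this]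
  have hLC := leviCivita_isLeviCivita g
  set e := trivializationAt EN (fun x : N => TangentSpace 𝓘(ℝ, EN) x) (p x) with he
  have hpx : p x ∈ e.baseSet := mem_baseSet_trivializationAt' (p x)
  let f : M → EN := fun y => extChartAt 𝓘(ℝ, EN) (p x) (p y)
  have hf : ContMDiffAt 𝓘(ℝ, E) 𝓘(ℝ, EN) ∞ f x :=
    (contMDiffAt_extChartAt (x := p x)).comp x (hp.smooth x)
  have hdf := eventually_mvfderiv_extChartAt_comp hp.smooth x
  let ξ : M → EN := fun y => (e ⟨p y, mfderiv 𝓘(ℝ, E) 𝓘(ℝ, EN) p y (X y)⟩).2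
  have hξ : MDiffAt ξ x := by
    have h1 : MDiffAt (fun y => TotalSpace.mk' EN (E := fun x : N => TangentSpace 𝓘(ℝ, EN) x) (p y)
        (mfderiv 𝓘(ℝ, E) 𝓘(ℝ, EN) p y (X y))) x :=
      ((hp.smooth.contMDiff_tangentMap (m := ∞) (by simp)).contMDiffAt.mdifferentiableAt
        (by simp)).comp x hX
    exact ((mdifferentiableAt_totalSpace 𝓘(ℝ, EN) _).1 h1).2
  have hWx : mfderiv 𝓘(ℝ, E) 𝓘(ℝ, EN) p x (W x) = 0 := hWv x
  set ξ' : E →L[ℝ] EN := mfderiv 𝓘(ℝ, E) 𝓘(ℝ, EN) ξ x with hξ'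
  have hξ'' : HasMFDerivWithinAt 𝓘(ℝ, E) 𝓘(ℝ, EN) ξ Set.univ x ξ' :=
    hasMFDerivWithinAt_univ.2 hξ.hasMFDerivAt
  -- Here dp(X) is only a field along p, so g_N(dp X, dp X) = g(X, X) is differentiated along p.
  obtain ⟨f', hf', hf'u⟩ := (gN.smoothBilinAt (p x)).hasMFDerivWithinAt_along
    (hasMFDerivWithinAt_univ.2 ((hp.smooth x).mdifferentiableAt (by simp)).hasMFDerivAt)
    (fun y => mfderiv 𝓘(ℝ, E) 𝓘(ℝ, EN) p y (X y)) (fun y => mfderiv 𝓘(ℝ, E) 𝓘(ℝ, EN) p y (X y))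
    hξ'' hξ''
  rw [Set.insert_eq_of_mem (Set.mem_univ x)] at hf'
  replace hf' := hasMFDerivWithinAt_univ.1 hf'
  have hfun : (fun y => g.inner y (X y) (X y)) = fun y => gN.inner (p y)
      (mfderiv 𝓘(ℝ, E) 𝓘(ℝ, EN) p y (X y)) (mfderiv 𝓘(ℝ, E) 𝓘(ℝ, EN) p y (X y)) :=
    funext fun y => hp.inner_horizontal _ (horizontalProj_mem EN g p y _)
  have h1 := hLC.metric x X X (W x) hX hX
  have h2 : d% (fun y => g.inner y (X y) (X y)) x (W x) = f' (W x) := by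
    rw [hfun, mvfderiv, hf'.mfderiv]
    rfl
  -- Since dp(W) = 0, the term differentiating g_N itself drops out. What remains says g(∇_W X, X) =
  -- g_N(ξ'(W), dp X).
  have hz : ∀ L : TangentSpace 𝓘(ℝ, EN) (p x) →L[ℝ] ℝ,
      L (mfderiv 𝓘(ℝ, E) 𝓘(ℝ, EN) p x (W x)) = 0 := fun L => by rw [hWx, map_zero]
  have h3 : f' (W x) = 2 * gN.inner (p x) (e.symm (p x) (ξ' (W x)))
      (mfderiv 𝓘(ℝ, E) 𝓘(ℝ, EN) p x (X x)) :=
    (hf'u (W x)).trans ((congrArg₂ (· + ·) (congrArg₂ (· + ·) (hz _) rfl)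
      (gN.symm _ _ _)).trans (by ring))
  have h4 := hLC.sub_eq_mlieBracket hX hW
  have h5 := mvfderiv_mlieBracket hf hX hW
  -- The function f factors through p, so Wf = 0 near x and the bracket formula reduces to [X, W]f =
  -- -W(Xf), that is dp[X, W] = -ξ'(W).
  have h6 : d% (fun y => d% f y (W y)) x (X x) = 0 := by
    have h : (fun y => d% f y (W y)) =ᶠ[nhds x] fun _ => (0 : EN) := by
      filter_upwards [hdf, hp.smooth.continuous.continuousAt.eventually
        (e.open_baseSet.mem_nhds hpx)] with y hy hye
      have hWy : mfderiv 𝓘(ℝ, E) 𝓘(ℝ, EN) p y (W y) = 0 := hWv y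
      refine (hy (W y)).trans ?_
      rw [hWy, ← Trivialization.continuousLinearMapAt_apply_of_mem (R := ℝ) e hye, map_zero]
    rw [mvfderiv, ((hasMFDerivAt_const (0 : EN) x).congr_of_eventuallyEq h).mfderiv]
    rfl
  have h7 : d% (fun y => d% f y (X y)) x (W x) = ξ' (W x) := by
    have h : (fun y => d% f y (X y)) =ᶠ[nhds x] ξ := by
      filter_upwards [hdf] with y hy
      exact hy _
    rw [mvfderiv, (hξ.hasMFDerivAt.congr_of_eventuallyEq h).mfderiv]
    rfl
  have h8 := hp.inner_horizontal (mlieBracket 𝓘(ℝ, E) X W x) hu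
  have h9 : mfderiv 𝓘(ℝ, E) 𝓘(ℝ, EN) p x (mlieBracket 𝓘(ℝ, E) X W x) =
      - e.symm (p x) (ξ' (W x)) := by
    have h := hdf.self_of_nhds (mlieBracket 𝓘(ℝ, E) X W x)
    rw [h6, h7, zero_sub] at h5
    have h10 := congrArg (e.symm (p x)) (h.symm.trans h5)
    rw [e.symm_apply_apply_mk hpx] at h10
    rw [h10, ← e.symmL_apply (R := ℝ) hpx, ← e.symmL_apply (R := ℝ) hpx, map_neg]
  rw [hXu] at h1 h3 h4
  rw [h9, ← h4] at h8
  -- As ∇_X W = [X, W] + ∇_W X, the contributions -g_N(ξ'(W), dp u) and +g_N(ξ'(W), dp u) to g(∇_u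
  -- W, u) cancel.
  simp only [map_sub, map_neg, sub_apply, neg_apply] at h8
  rw [g.symm x u, h2, h3] at h1
  linarith
/-! ### The covariant derivative of the vertical projection -/

/-- The derivative terms df · AY produced by the Leibniz rule in ∇(A(fY)) and in A(∇(fY)) cancel. -/
theorem covDerivEnd_tensorial (D : AffineConnection E M) {A : EndField E M} {x : M}
    (hA : SmoothEndAt A x) : TensorialAt 𝓘(ℝ, E) E (fun Y => covDerivEnd D A Y x) x where
  smul {f Y} hf hY := by
    have h1 : (fun y => A y ((f • Y) y)) = f • fun y => A y (Y y) := by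
      funext y
      simp
    rw [covDerivEnd, covDerivEnd, h1, D.isCovariantDerivativeOn.leibniz (hA.mdiffAt_apply hY) hf
      (Set.mem_univ x), D.isCovariantDerivativeOn.leibniz hY hf (Set.mem_univ x)]
    ext u
    simp [smul_sub]
  add {Y Y'} hY hY' := by
    have h1 : (fun y => A y ((Y + Y') y)) = (fun y => A y (Y y)) + fun y => A y (Y' y) := by
      funext y
      simp
    rw [covDerivEnd, covDerivEnd, covDerivEnd, h1, D.isCovariantDerivativeOn.add
      (hA.mdiffAt_apply hY) (hA.mdiffAt_apply hY') (Set.mem_univ x),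
      D.isCovariantDerivativeOn.add hY hY' (Set.mem_univ x)]
    ext u
    simp
    abel

/-- The covariant derivative of a smooth field of endomorphisms `A` as a tensor:
`covDerivTensor D hA v u` is `(∇_u A) v`. -/
def covDerivTensor (D : AffineConnection E M) {A : EndField E M} {x : M} (hA : SmoothEndAt A x) :
    TangentSpace 𝓘(ℝ, E) x →L[ℝ] TangentSpace 𝓘(ℝ, E) x →L[ℝ] TangentSpace 𝓘(ℝ, E) x :=
  TensorialAt.mkHom (fun Y => covDerivEnd D A Y x) x (covDerivEnd_tensorial D hA)

theorem covDerivTensor_apply (D : AffineConnection E M) {A : EndField E M} {x : M}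
    (hA : SmoothEndAt A x) {Y : Π y : M, TangentSpace 𝓘(ℝ, E) y} (hY : MDiffAt (T% Y) x) :
    covDerivTensor D hA (Y x) = covDerivEnd D A Y x :=
  TensorialAt.mkHom_apply (covDerivEnd_tensorial D hA) hY

variable (EN) in
theorem verticalProj_verticalProj (g : RiemMetric E M) (p : M → N) (x : M)
    (u : TangentSpace 𝓘(ℝ, E) x) :
    verticalProj EN g p x (verticalProj EN g p x u) = verticalProj EN g p x u :=
  verticalProj_of_mem (verticalProj_mem EN g p x u)

variable (EN) in
/-- The laws satisfied by the covariant derivative `S v u = (∇_u 𝒱) v` of the vertical projection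
of a Riemannian submersion with totally geodesic fibers whose total space is Kähler with complex
structure preserving the vertical and the horizontal spaces. -/
structure ProjDerivLaws (g : RiemMetric E M) (p : M → N) (J : EndField E M) (x : M)
    (S : TangentSpace 𝓘(ℝ, E) x →L[ℝ] TangentSpace 𝓘(ℝ, E) x →L[ℝ] TangentSpace 𝓘(ℝ, E) x) :
    Prop where
  proj_add_apply_proj : ∀ u v, verticalProj EN g p x (S v u) + S (verticalProj EN g p x v) u = S v u
  inner_comm : ∀ u v w, g.inner x (S v u) w = g.inner x v (S w u)
  apply_vertical : ∀ u v, S v (verticalProj EN g p x u) = 0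
  skew_horizontal : ∀ u v, S (v - verticalProj EN g p x v) u = -S (u - verticalProj EN g p x u) v
  apply_J : ∀ u v, S (J x v) u = J x (S v u)
  proj_J : ∀ u, verticalProj EN g p x (J x u) = J x (verticalProj EN g p x u)
  J_J : ∀ u, J x (J x u) = -u
  inner_J_J : ∀ u v, g.inner x (J x u) (J x v) = g.inner x u v

section laws

variable {g : RiemMetric E M} {gN : RiemMetric EN N} {p : M → N}

/-- This is the derivative of 𝒱² = 𝒱. -/
theorem covDerivTensor_verticalProj_add (hp : IsRiemannianSubmersion g gN p)
    (D : AffineConnection E M) (x : M) (u v : TangentSpace 𝓘(ℝ, E) x) :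
    verticalProj EN g p x (covDerivTensor D (hp.smoothEndAt_verticalProj x) v u)
      + covDerivTensor D (hp.smoothEndAt_verticalProj x) (verticalProj EN g p x v) u
      = covDerivTensor D (hp.smoothEndAt_verticalProj x) v u := by
  have hS := hp.smoothEndAt_verticalProj x
  have hY : MDiffAt (T% (extend E v : Π y : M, TangentSpace 𝓘(ℝ, E) y)) x :=
    mdifferentiableAt_extend ..
  have h1 := covDerivTensor_apply D hS hY
  have h2 := covDerivTensor_apply D hS (hS.mdiffAt_apply hY)
  simp only [extend_apply_self] at h1 h2
  rw [h1, h2]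
  simp [covDerivEnd, verticalProj_verticalProj]

/-- Both sides come from differentiating g(𝒱v, w) = g(v, 𝒱w) with a metric connection. -/
theorem inner_covDerivTensor_comm (hp : IsRiemannianSubmersion g gN p) {D : AffineConnection E M}
    (hD : IsLeviCivita g D) (x : M) (u v w : TangentSpace 𝓘(ℝ, E) x) :
    g.inner x (covDerivTensor D (hp.smoothEndAt_verticalProj x) v u) w =
      g.inner x v (covDerivTensor D (hp.smoothEndAt_verticalProj x) w u) := by
  have hS := hp.smoothEndAt_verticalProj x
  have hY : ∀ v : TangentSpace 𝓘(ℝ, E) x,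
      MDiffAt (T% (extend E v : Π y : M, TangentSpace 𝓘(ℝ, E) y)) x :=
    fun v => mdifferentiableAt_extend ..
  have h1 := covDerivTensor_apply D hS (hY v)
  have h2 := covDerivTensor_apply D hS (hY w)
  have h3 := hD.metric x _ _ u (hS.mdiffAt_apply (hY v)) (hY w)
  have h4 := hD.metric x _ _ u (hY v) (hS.mdiffAt_apply (hY w))
  simp only [inner_verticalProj_comm EN g p] at h3
  rw [h3] at h4
  simp only [extend_apply_self] at h1 h2 h4
  rw [h1, h2]
  simp only [covDerivEnd, sub_apply, map_sub, ContinuousLinearMap.comp_apply,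
    inner_verticalProj_comm EN g p x (D (extend E v) x u) w]
  rw [← inner_verticalProj_comm EN g p x v]
  rw [← inner_verticalProj_comm EN g p x v] at h4
  linarith

/-- On a vertical W, (∇_U 𝒱) W = ∇_U W - 𝒱∇_U W vanishes because the fibers are totally geodesic.
The derivative of 𝒱² = 𝒱 then leaves only the vertical part of S v U, and self-adjointness reduces
that part to the same vanishing. -/
theorem covDerivTensor_apply_vertical (hp : IsRiemannianSubmersion g gN p)
    (hgeo : HasTotallyGeodesicFibers EN g p) (x : M) (u v : TangentSpace 𝓘(ℝ, E) x) :
    covDerivTensor (leviCivita g) (hp.smoothEndAt_verticalProj x) v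
      (verticalProj EN g p x u) = 0 := by
  have hS := hp.smoothEndAt_verticalProj x
  have key : ∀ w, covDerivTensor (leviCivita g) (hp.smoothEndAt_verticalProj x)
      (verticalProj EN g p x w) (verticalProj EN g p x u) = 0 := by
    intro w
    have hY : MDiffAt (T% (extend E w : Π y : M, TangentSpace 𝓘(ℝ, E) y)) x :=
      mdifferentiableAt_extend ..
    have h2 := covDerivTensor_apply (leviCivita g) hS (hS.mdiffAt_apply hY)
    have h3 := hgeo x _ (hS.mdiffAt_apply hY) (fun y => verticalProj_mem EN g p y _) _
      (verticalProj_mem EN g p x u)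
    simp only [extend_apply_self] at h2
    rw [h2]
    simp only [covDerivEnd, verticalProj_verticalProj, sub_apply, ContinuousLinearMap.comp_apply,
      verticalProj_of_mem h3, sub_self]
  refine g.ext_inner fun w => ?_
  rw [← covDerivTensor_verticalProj_add hp, key, add_zero, inner_verticalProj_comm,
    inner_covDerivTensor_comm hp (leviCivita_isLeviCivita g), key]
  simp

/-- For horizontal u the vector S u u is vertical. Its product with W = 𝒱w is g(u, S W u) = g(u, ∇_u
W), which vanishes for a Riemannian submersion. -/
theorem covDerivTensor_self_horizontal (hp : IsRiemannianSubmersion g gN p) {x : M}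
    {u : TangentSpace 𝓘(ℝ, E) x} (hu : u ∈ horizontalSpace EN g p x) :
    covDerivTensor (leviCivita g) (hp.smoothEndAt_verticalProj x) u u = 0 := by
  have hS := hp.smoothEndAt_verticalProj x
  refine g.ext_inner fun w => ?_
  have hY : MDiffAt (T% (extend E w : Π y : M, TangentSpace 𝓘(ℝ, E) y)) x :=
    mdifferentiableAt_extend ..
  have h1 := covDerivTensor_apply (leviCivita g) hS (hS.mdiffAt_apply hY)
  have h2 := hp.inner_leviCivita_vertical (hS.mdiffAt_apply hY)
    (fun y => verticalProj_mem EN g p y _) hu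
  simp only [extend_apply_self] at h1
  have h3 := covDerivTensor_verticalProj_add hp (leviCivita g) x u u
  rw [verticalProj_of_mem_horizontal hu, map_zero, zero_apply, add_zero] at h3
  rw [← h3, inner_verticalProj_comm, inner_covDerivTensor_comm hp (leviCivita_isLeviCivita g), h1,
    g.symm]
  simp only [covDerivEnd, verticalProj_verticalProj, sub_apply, ContinuousLinearMap.comp_apply,
    map_sub, h2, hu _ (verticalProj_mem EN g p x _), map_zero, zero_apply, sub_zero]

/-- Polarization of S u u = 0 on horizontal vectors; the vertical parts of the second arguments
contribute nothing because the fibers are totally geodesic. -/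
theorem covDerivTensor_skew (hp : IsRiemannianSubmersion g gN p)
    (hgeo : HasTotallyGeodesicFibers EN g p) (x : M) (u v : TangentSpace 𝓘(ℝ, E) x) :
    covDerivTensor (leviCivita g) (hp.smoothEndAt_verticalProj x)
        (v - verticalProj EN g p x v) u =
      -covDerivTensor (leviCivita g) (hp.smoothEndAt_verticalProj x)
        (u - verticalProj EN g p x u) v := by
  have hh : ∀ w, w - verticalProj EN g p x w ∈ horizontalSpace EN g p x :=
    horizontalProj_mem EN g p x
  have h1 := covDerivTensor_self_horizontal hp (Submodule.add_mem _ (hh u) (hh v))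
  have h2 := covDerivTensor_self_horizontal hp (hh u)
  have h3 := covDerivTensor_self_horizontal hp (hh v)
  simp only [map_add, add_apply, h2, h3] at h1
  rw [zero_add, add_zero, map_sub _ u (verticalProj EN g p x u),
    map_sub _ v (verticalProj EN g p x v)] at h1
  simp only [map_sub, sub_apply, covDerivTensor_apply_vertical hp hgeo] at h1 ⊢
  rw [eq_neg_iff_add_eq_zero]
  simpa using h1

/-- J is parallel and commutes with 𝒱, so it commutes with every derivative of 𝒱. -/
theorem covDerivTensor_apply_J (hp : IsRiemannianSubmersion g gN p) {J : EndField E M}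
    (hJ : IsKahler g J)
    (hV : ∀ x, ∀ u ∈ verticalSpace E EN p x, J x u ∈ verticalSpace E EN p x)
    (hH : ∀ x, ∀ u ∈ horizontalSpace EN g p x, J x u ∈ horizontalSpace EN g p x) (x : M)
    (u v : TangentSpace 𝓘(ℝ, E) x) :
    covDerivTensor (leviCivita g) (hp.smoothEndAt_verticalProj x) (J x v) u =
      J x (covDerivTensor (leviCivita g) (hp.smoothEndAt_verticalProj x) v u) := by
  have hS := hp.smoothEndAt_verticalProj x
  have hJs : SmoothEndAt J x := hJ.almostHermitian.smooth x
  have hY : MDiffAt (T% (extend E v : Π y : M, TangentSpace 𝓘(ℝ, E) y)) x :=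
    mdifferentiableAt_extend ..
  have h1 := covDerivTensor_apply (leviCivita g) hS hY
  have h2 := covDerivTensor_apply (leviCivita g) hS (hJs.mdiffAt_apply hY)
  have h3 := congr($(hJ.parallel x _ hY) u)
  have h4 := congr($(hJ.parallel x _ (hS.mdiffAt_apply hY)) u)
  have hc : ∀ y w, verticalProj EN g p y (J y w) = J y (verticalProj EN g p y w) := fun y =>
    verticalProj_comm_of_preserves (hV y) (hH y)
  simp only [extend_apply_self] at h1 h2
  rw [h1, h2]
  simp only [covDerivEnd, sub_apply, ContinuousLinearMap.comp_apply, zero_apply, sub_eq_zero, hc,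
    map_sub] at h3 h4 ⊢
  rw [h3, h4, hc]

theorem projDerivLaws (hp : IsRiemannianSubmersion g gN p)
    (hgeo : HasTotallyGeodesicFibers EN g p) {J : EndField E M} (hJ : IsKahler g J)
    (hV : ∀ x, ∀ u ∈ verticalSpace E EN p x, J x u ∈ verticalSpace E EN p x)
    (hH : ∀ x, ∀ u ∈ horizontalSpace EN g p x, J x u ∈ horizontalSpace EN g p x) (x : M) :
    ProjDerivLaws EN g p J x
      (covDerivTensor (leviCivita g) (hp.smoothEndAt_verticalProj x)) where
  proj_add_apply_proj := covDerivTensor_verticalProj_add hp _ x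
  inner_comm := inner_covDerivTensor_comm hp (leviCivita_isLeviCivita g) x
  apply_vertical := covDerivTensor_apply_vertical hp hgeo x
  skew_horizontal := covDerivTensor_skew hp hgeo x
  apply_J := covDerivTensor_apply_J hp hJ hV hH x
  proj_J := verticalProj_comm_of_preserves (hV x) (hH x)
  J_J := hJ.almostHermitian.sq x
  inner_J_J := hJ.almostHermitian.compatible x

end laws

/-! ### The Levi-Civita connection of the squashed metric -/

theorem reversedJ_apply (g : RiemMetric E M) (p : M → N) (J : EndField E M) (x : M)
    (u : TangentSpace 𝓘(ℝ, E) x) :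
    reversedJ EN g p J x u = J x (u - (2 : ℝ) • verticalProj EN g p x u) := by
  simp only [reversedJ, horizontalProj, sub_apply, ContinuousLinearMap.comp_apply,
    ContinuousLinearMap.id_apply, ← map_sub, two_smul]
  congr 1
  abel

theorem verticalProj_reflection (g : RiemMetric E M) (p : M → N) (x : M)
    (u : TangentSpace 𝓘(ℝ, E) x) :
    verticalProj EN g p x (u - (2 : ℝ) • verticalProj EN g p x u) = -verticalProj EN g p x u := by
  rw [map_sub, map_smul, verticalProj_verticalProj]
  module

variable (EN) in
/-- The difference of the Levi-Civita connections of the squashed and the original metric, in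
terms of the covariant derivative `S` of the vertical projection. -/
def squashedDifference (g : RiemMetric E M) (p : M → N) (x : M)
    (S : TangentSpace 𝓘(ℝ, E) x →L[ℝ] TangentSpace 𝓘(ℝ, E) x →L[ℝ] TangentSpace 𝓘(ℝ, E) x) :
    TangentSpace 𝓘(ℝ, E) x →L[ℝ] TangentSpace 𝓘(ℝ, E) x →L[ℝ] TangentSpace 𝓘(ℝ, E) x :=
  have : FiniteDimensional ℝ (TangentSpace 𝓘(ℝ, E) x) := inferInstanceAs (FiniteDimensional ℝ E)
  have : T2Space (TangentSpace 𝓘(ℝ, E) x) := inferInstanceAs (T2Space E)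
  (LinearMap.mk₂ ℝ (fun v u : TangentSpace 𝓘(ℝ, E) x => (-(1 / 2) : ℝ) •
      (S (verticalProj EN g p x v) u + S (verticalProj EN g p x u) v))
    (fun _ _ _ => by simp only [map_add, add_apply]; module)
    (fun _ _ _ => by simp only [map_smul, smul_apply]; module)
    (fun _ _ _ => by simp only [map_add, add_apply]; module)
    (fun _ _ _ => by simp only [map_smul, smul_apply]; module)).toContinuousBilinearMap

variable (EN) in
theorem squashedDifference_apply (g : RiemMetric E M) (p : M → N) (x : M)
    (S : TangentSpace 𝓘(ℝ, E) x →L[ℝ] TangentSpace 𝓘(ℝ, E) x →L[ℝ] TangentSpace 𝓘(ℝ, E) x)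
    (v u : TangentSpace 𝓘(ℝ, E) x) : squashedDifference EN g p x S v u =
      (-(1 / 2) : ℝ) • (S (verticalProj EN g p x v) u + S (verticalProj EN g p x u) v) := rfl

/-! ### Algebraic consequences of the laws for S -/

namespace ProjDerivLaws

variable {g : RiemMetric E M} {p : M → N} {J : EndField E M} {x : M}
  {S : TangentSpace 𝓘(ℝ, E) x →L[ℝ] TangentSpace 𝓘(ℝ, E) x →L[ℝ] TangentSpace 𝓘(ℝ, E) x}

theorem proj_apply_proj (h : ProjDerivLaws EN g p J x S) (u v : TangentSpace 𝓘(ℝ, E) x) :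
    verticalProj EN g p x (S (verticalProj EN g p x v) u) = 0 := by
  have := h.proj_add_apply_proj u (verticalProj EN g p x v)
  rw [verticalProj_verticalProj] at this
  simpa using this

/-- Linearity over J in the first slot becomes antilinearity in the second slot for vertical first
arguments: skewness gives S w (J u) = J (S w u) for horizontal w, and taking adjoints changes the
sign because J is skew-adjoint. -/
theorem apply_proj_J (h : ProjDerivLaws EN g p J x S) (u v : TangentSpace 𝓘(ℝ, E) x) :
    S (verticalProj EN g p x v) (J x u) = -J x (S (verticalProj EN g p x v) u) := by
  have hskew : ∀ u v w, g.inner x v (S (w - verticalProj EN g p x w) (J x u)) =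
      -g.inner x (J x v) (S (w - verticalProj EN g p x w) u) := by
    intro u v w
    have h1 : J x u - verticalProj EN g p x (J x u) = J x (u - verticalProj EN g p x u) := by
      rw [h.proj_J, map_sub]
    rw [h.skew_horizontal (J x u) w, h1, h.apply_J, ← map_neg, ← h.skew_horizontal,
      ← h.inner_J_J v, h.J_J, map_neg]
  refine g.ext_inner fun w => ?_
  have h2 : ∀ a u, verticalProj EN g p x (S a u) = S (a - verticalProj EN g p x a) u := by
    intro a u
    rw [map_sub, sub_apply]
    exact eq_sub_of_add_eq (h.proj_add_apply_proj u a)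
  rw [h.inner_comm, inner_verticalProj_comm, h2, hskew, ← h2, ← inner_verticalProj_comm,
    ← h.inner_comm, h.proj_J, h.apply_J, map_neg, neg_apply]

/-- Since ĝ = g - ½ g(𝒱·,·), the right-hand side is (∇_u ĝ)(v, w). The identity is therefore exactly
the condition for ∇ + D to preserve ĝ. -/
theorem squashedInner_difference (h : ProjDerivLaws EN g p J x S)
    (u v w : TangentSpace 𝓘(ℝ, E) x) :
    squashedInner EN g p x (squashedDifference EN g p x S v u) w
      + squashedInner EN g p x v (squashedDifference EN g p x S w u)
      = -(1 / 2) * g.inner x (S v u) w := by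
  -- D takes horizontal values, so ĝ may be replaced by g in every product with D.
  have hV : ∀ a b, verticalProj EN g p x (squashedDifference EN g p x S a b) = 0 := by
    intro a b
    rw [squashedDifference_apply, map_smul, map_add, h.proj_apply_proj, h.proj_apply_proj]
    simp
  rw [squashedInner_eq_sub, squashedInner_eq_sub, hV, inner_verticalProj_comm, hV,
    squashedDifference_apply, squashedDifference_apply, g.symm x v]
  have h1 := congr(g.inner x $(h.proj_add_apply_proj u v) w)
  have h2 : g.inner x (S (verticalProj EN g p x w) u) v =
      g.inner x (verticalProj EN g p x (S v u)) w := by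
    rw [g.symm, ← h.inner_comm, ← inner_verticalProj_comm]
  -- The terms of D containing 𝒱u cancel, by skewness of S on horizontal pairs moved through the
  -- adjoint.
  have h3 : g.inner x (S (verticalProj EN g p x u) v) w +
      g.inner x (S (verticalProj EN g p x u) w) v = 0 := by
    have h4 := congr(g.inner x u $(h.skew_horizontal v w))
    have h5 : ∀ a b, S (a - verticalProj EN g p x a) b = verticalProj EN g p x (S a b) := by
      intro a b
      rw [map_sub, sub_apply]
      exact (eq_sub_of_add_eq (h.proj_add_apply_proj b a)).symm
    rw [h5, h5, map_neg, ← inner_verticalProj_comm, ← inner_verticalProj_comm, ← h.inner_comm,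
      ← h.inner_comm] at h4
    linarith
  simp only [map_smul, map_add, map_zero, smul_apply, add_apply, zero_apply, smul_eq_mul] at h1 ⊢
  linarith

end ProjDerivLaws

section squashed

variable {g : RiemMetric E M} {gN : RiemMetric EN N} {p : M → N}

/-- The Levi-Civita connection of the squashed metric, as a modification of that of `g`. -/
def squashedConnection (hp : IsRiemannianSubmersion g gN p) : AffineConnection E M :=
  (leviCivita g).addOneForm fun x => squashedDifference EN g p x
    (covDerivTensor (leviCivita g) (hp.smoothEndAt_verticalProj x))

theorem squashedConnection_apply (hp : IsRiemannianSubmersion g gN p)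
    (Y : Π y : M, TangentSpace 𝓘(ℝ, E) y) (x : M) (u : TangentSpace 𝓘(ℝ, E) x) :
    squashedConnection hp Y x u = leviCivita g Y x u + squashedDifference EN g p x
      (covDerivTensor (leviCivita g) (hp.smoothEndAt_verticalProj x)) (Y x) u := rfl

/-- Adding D does not change the torsion because D is symmetric, and `squashedInner_difference`
makes the sum metric for ĝ. -/
theorem isLeviCivita_squashedConnection (hp : IsRiemannianSubmersion g gN p) {J : EndField E M}
    (h : ∀ x, ProjDerivLaws EN g p J x
      (covDerivTensor (leviCivita g) (hp.smoothEndAt_verticalProj x))) :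
    IsLeviCivita (squashedMetric g gN p hp) (squashedConnection hp) := by
  have hLC := leviCivita_isLeviCivita g
  constructor
  · rw [CovariantDerivative.torsion_eq_zero_iff]
    intro X Y x hX hY
    rw [squashedConnection_apply, squashedConnection_apply, ← hLC.sub_eq_mlieBracket hX hY,
      squashedDifference_apply, squashedDifference_apply]
    module
  · intro x Y Z u hY hZ
    have hS := hp.smoothEndAt_verticalProj x
    have h1 : (fun y => (squashedMetric g gN p hp).inner y (Y y) (Z y)) = fun y =>
        g.inner y (Y y) (Z y) + (-(1 / 2)) * g.inner y (verticalProj EN g p y (Y y)) (Z y) := by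
      funext y
      refine (squashedInner_eq_sub g p y _ _).trans ?_
      ring
    have h2 := hLC.metric x _ _ u hY hZ
    have h3 := hLC.metric x _ _ u (hS.mdiffAt_apply hY) hZ
    have h4 := (h x).squashedInner_difference u (Y x) (Z x)
    have h5 := congr(g.inner x $(congr($(covDerivTensor_apply (leviCivita g) hS hY) u)) (Z x))
    have hc : MDiffAt (fun _ : M => (-(1 / 2) : ℝ)) x := mdifferentiableAt_const
    have hm : MDiffAt (fun y => (-(1 / 2)) * g.inner y (verticalProj EN g p y (Y y)) (Z y)) x :=
      hc.mul (g.mdiffAt (hS.mdiffAt_apply hY) hZ)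
    rw [h1, mvfderiv_fun_add (g.mdiffAt hY hZ) hm,
      mvfderiv_fun_mul hc (g.mdiffAt (hS.mdiffAt_apply hY) hZ),
      squashedConnection_apply, squashedConnection_apply]
    change _ = squashedInner EN g p x _ _ + squashedInner EN g p x _ _
    simp only [map_add, add_apply, covDerivEnd, sub_apply, map_sub, smul_apply,
      ContinuousLinearMap.comp_apply, mvfderiv_const, smul_zero, zero_apply, h2, h3,
      smul_eq_mul] at h5 ⊢
    rw [squashedInner_eq_sub g p x (leviCivita g Y x u), squashedInner_eq_sub g p x (Y x)]
    linarith

theorem leviCivita_squashedMetric_apply (hp : IsRiemannianSubmersion g gN p) {J : EndField E M}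
    (h : ∀ x, ProjDerivLaws EN g p J x
      (covDerivTensor (leviCivita g) (hp.smoothEndAt_verticalProj x))) {x : M}
    {Y : Π y : M, TangentSpace 𝓘(ℝ, E) y} (hY : MDiffAt (T% Y) x) :
    leviCivita (squashedMetric g gN p hp) Y x = squashedConnection hp Y x :=
  (leviCivita_isLeviCivita _).unique (isLeviCivita_squashedConnection hp h) hY

end squashed

/-! ### The nearly Kähler structure and its canonical Hermitian connection -/

section nearlyKahler

variable {g : RiemMetric E M} {gN : RiemMetric EN N} {p : M → N} {J : EndField E M}

theorem smoothEndAt_reversedJ (hp : IsRiemannianSubmersion g gN p) {x : M} (hJ : SmoothEndAt J x) :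
    SmoothEndAt (reversedJ EN g p J) x :=
  (hJ.comp (hp.smoothEndAt_horizontalProj x)).sub (hJ.comp (hp.smoothEndAt_verticalProj x))

theorem isAlmostHermitian_reversedJ (hp : IsRiemannianSubmersion g gN p)
    (hJ : IsAlmostHermitian g J)
    (hc : ∀ x u, verticalProj EN g p x (J x u) = J x (verticalProj EN g p x u)) :
    IsAlmostHermitian (squashedMetric g gN p hp) (reversedJ EN g p J) where
  smooth x := smoothEndAt_reversedJ hp (hJ.smooth x)
  sq x u := by
    -- The reflection 1 - 2𝒱 is an involution commuting with J, so Ĵ² = J².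
    have h1 : J x (u - (2 : ℝ) • verticalProj EN g p x u) - (2 : ℝ) • verticalProj EN g p x
        (J x (u - (2 : ℝ) • verticalProj EN g p x u)) = J x u := by
      rw [hc, verticalProj_reflection, ← map_smul (J x), ← map_sub (J x)]
      congr 1
      module
    rw [reversedJ_apply, reversedJ_apply, h1, hJ.sq]
  compatible x u v := by
    change squashedInner EN g p x _ _ = squashedInner EN g p x _ _
    rw [squashedInner_eq_sub, squashedInner_eq_sub, reversedJ_apply, reversedJ_apply, hc,
      hJ.compatible, hJ.compatible, verticalProj_reflection]
    have h1 := inner_verticalProj_left EN g p x u v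
    have h2 := inner_verticalProj_comm EN g p x u v
    simp only [map_sub, map_smul, map_neg, sub_apply, smul_apply, neg_apply, smul_eq_mul]
    linarith

/-- With Ĵ = J(1 - 2𝒱) and ∇J = 0, the connection ∇ contributes -2 J (S Y u). The difference tensor
contributes D(ĴY) u - Ĵ(D Y u) = -2 J (D Y u). -/
theorem covDerivEnd_reversedJ (hp : IsRiemannianSubmersion g gN p) (hJ : IsKahler g J)
    (h : ∀ x, ProjDerivLaws EN g p J x
      (covDerivTensor (leviCivita g) (hp.smoothEndAt_verticalProj x))) {x : M}
    {Y : Π y : M, TangentSpace 𝓘(ℝ, E) y} (hY : MDiffAt (T% Y) x) (u : TangentSpace 𝓘(ℝ, E) x) :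
    covDerivEnd (leviCivita (squashedMetric g gN p hp)) (reversedJ EN g p J) Y x u =
      J x ((-2 : ℝ) • covDerivTensor (leviCivita g) (hp.smoothEndAt_verticalProj x) (Y x) u
        + covDerivTensor (leviCivita g) (hp.smoothEndAt_verticalProj x)
          (verticalProj EN g p x (Y x)) u
        + covDerivTensor (leviCivita g) (hp.smoothEndAt_verticalProj x)
          (verticalProj EN g p x u) (Y x)) := by
  have hS := hp.smoothEndAt_verticalProj x
  have hJx : SmoothEndAt J x := hJ.almostHermitian.smooth x
  have hJY : MDiffAt (T% (fun y => reversedJ EN g p J y (Y y))) x :=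
    (smoothEndAt_reversedJ hp hJx).mdiffAt_apply hY
  have hVY := hS.mdiffAt_apply hY
  have hcY : MDiffAt (T% ((-2 : ℝ) • fun y => verticalProj EN g p y (Y y))) x :=
    mdifferentiableAt_const.smul_section hVY
  have hZ := mdifferentiableAt_add_section hY hcY
  have hfun : (fun y => reversedJ EN g p J y (Y y)) = fun y =>
      J y ((Y + (-2 : ℝ) • fun y => verticalProj EN g p y (Y y)) y) := by
    funext y
    rw [reversedJ_apply]
    congr 1
    simp [sub_eq_add_neg]
  have h1 := congr($(hJ.parallel x _ hZ) u)
  rw [covDerivEnd, ← hfun, sub_apply, zero_apply, sub_eq_zero, ContinuousLinearMap.comp_apply,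
    (leviCivita g).isCovariantDerivativeOn.add hY hcY (Set.mem_univ x),
    (leviCivita g).isCovariantDerivativeOn.smul_const _ hVY (Set.mem_univ x), add_apply,
    smul_apply] at h1
  have h2 := congr($(covDerivTensor_apply (leviCivita g) hS hY) u)
  rw [covDerivEnd, sub_apply, ContinuousLinearMap.comp_apply, eq_sub_iff_add_eq] at h2
  set S := covDerivTensor (leviCivita g) (hp.smoothEndAt_verticalProj x) with hSdef
  have hx := h x
  rw [← hSdef] at hx
  rw [covDerivEnd, leviCivita_squashedMetric_apply hp h hJY,
    leviCivita_squashedMetric_apply hp h hY, sub_apply, ContinuousLinearMap.comp_apply,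
    squashedConnection_apply, squashedConnection_apply, h1, ← h2, ← hSdef]
  have h3 : verticalProj EN g p x (squashedDifference EN g p x S (Y x) u) = 0 := by
    rw [squashedDifference_apply, map_smul, map_add, hx.proj_apply_proj, hx.proj_apply_proj]
    simp
  -- Both terms of D acquire the sign -J: the first because Ĵ is -J on vertical vectors, the second
  -- by `apply_proj_J`.
  have h4 : squashedDifference EN g p x S (reversedJ EN g p J x (Y x)) u =
      -J x (squashedDifference EN g p x S (Y x) u) := by
    rw [squashedDifference_apply, squashedDifference_apply, reversedJ_apply, hx.proj_J,
      verticalProj_reflection, map_neg, map_neg, neg_apply, hx.apply_J, hx.apply_proj_J, map_sub,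
      map_smul, hx.apply_vertical, smul_zero, sub_zero, map_smul, map_add]
    module
  rw [h4, reversedJ_apply, map_add (verticalProj EN g p x), h3, squashedDifference_apply]
  simp only [map_add, map_sub, map_smul, add_zero]
  module

/-- The squashed metric and the reversed almost complex structure are nearly Kähler. -/
theorem isNearlyKahler_squashed (hp : IsRiemannianSubmersion g gN p) (hJ : IsKahler g J)
    (h : ∀ x, ProjDerivLaws EN g p J x
      (covDerivTensor (leviCivita g) (hp.smoothEndAt_verticalProj x))) :
    IsNearlyKahler (squashedMetric g gN p hp) (reversedJ EN g p J) where
  almostHermitian := isAlmostHermitian_reversedJ hp hJ.almostHermitian fun x => (h x).proj_J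
  skew x X hX := by
    rw [covDerivEnd_reversedJ hp hJ h hX]
    -- On the diagonal the expression is -2 S (X - 𝒱X) X, and skewness makes S (X - 𝒱X) X its own
    -- negative.
    have h1 := (h x).skew_horizontal (X x) (X x)
    rw [eq_neg_iff_add_eq_zero, ← two_smul ℝ, smul_eq_zero_iff_right (by norm_num), map_sub,
      sub_apply, sub_eq_zero] at h1
    rw [← h1]
    convert map_zero (J x) using 2
    module

/-- The D terms of ∇̂ cancel against half of the derivative of Ĵ applied to ĴY. The result is
𝒱∇_u(𝒱Y) + H∇_u(HY), the direct sum of the connections that ∇ induces on the two distributions. -/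
theorem canonicalHermitian_squashed_apply (hp : IsRiemannianSubmersion g gN p) (hJ : IsKahler g J)
    (h : ∀ x, ProjDerivLaws EN g p J x
      (covDerivTensor (leviCivita g) (hp.smoothEndAt_verticalProj x))) {x : M}
    {Y : Π y : M, TangentSpace 𝓘(ℝ, E) y} (hY : MDiffAt (T% Y) x) (u : TangentSpace 𝓘(ℝ, E) x) :
    canonicalHermitian (squashedMetric g gN p hp) (reversedJ EN g p J) Y x u =
      leviCivita g Y x u + covDerivTensor (leviCivita g) (hp.smoothEndAt_verticalProj x)
        (Y x - (2 : ℝ) • verticalProj EN g p x (Y x)) u := by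
  have hx := h x
  have hJx : SmoothEndAt J x := hJ.almostHermitian.smooth x
  have hJY : MDiffAt (T% (fun y => reversedJ EN g p J y (Y y))) x :=
    (smoothEndAt_reversedJ hp hJx).mdiffAt_apply hY
  rw [canonicalHermitian, add_apply, smul_apply, covDerivEnd_reversedJ hp hJ h hJY,
    leviCivita_squashedMetric_apply hp h hY, squashedConnection_apply, squashedDifference_apply,
    reversedJ_apply, hx.proj_J, verticalProj_reflection]
  simp only [map_neg, neg_apply, hx.apply_J, hx.apply_proj_J, map_sub, map_smul, map_add, sub_apply,
    smul_apply, hx.J_J, hx.apply_vertical]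
  module

/-- For vertical Y the formula gives ∇_u Y - S Y u = 𝒱∇_u Y. -/
theorem isParallelDistribution_vertical (hp : IsRiemannianSubmersion g gN p) (hJ : IsKahler g J)
    (h : ∀ x, ProjDerivLaws EN g p J x
      (covDerivTensor (leviCivita g) (hp.smoothEndAt_verticalProj x))) :
    IsParallelDistribution
      (canonicalHermitian (squashedMetric g gN p hp) (reversedJ EN g p J))
      (verticalSpace E EN p) := by
  intro x Y hY hYv u
  have h1 := congr($(covDerivTensor_apply (leviCivita g) (hp.smoothEndAt_verticalProj x) hY) u)
  have h2 : (fun y => verticalProj EN g p y (Y y)) = Y := funext fun y => verticalProj_of_mem (hYv y)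
  rw [covDerivEnd, h2, sub_apply, ContinuousLinearMap.comp_apply] at h1
  rw [canonicalHermitian_squashed_apply hp hJ h hY, verticalProj_of_mem (hYv x), map_sub, map_smul,
    sub_apply, smul_apply, h1]
  convert verticalProj_mem EN g p x (leviCivita g Y x u) using 1
  module

/-- For horizontal Y one has S Y u = -𝒱∇_u Y, so the formula gives the horizontal part of ∇_u Y. -/
theorem isParallelDistribution_horizontal (hp : IsRiemannianSubmersion g gN p) (hJ : IsKahler g J)
    (h : ∀ x, ProjDerivLaws EN g p J x
      (covDerivTensor (leviCivita g) (hp.smoothEndAt_verticalProj x))) :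
    IsParallelDistribution
      (canonicalHermitian (squashedMetric g gN p hp) (reversedJ EN g p J))
      (horizontalSpace EN g p) := by
  intro x Y hY hYh u
  have h1 := congr($(covDerivTensor_apply (leviCivita g) (hp.smoothEndAt_verticalProj x) hY) u)
  have h2 : (fun y => verticalProj EN g p y (Y y)) = 0 :=
    funext fun y => verticalProj_of_mem_horizontal (hYh y)
  rw [covDerivEnd, h2, CovariantDerivative.zero, sub_apply, ContinuousLinearMap.comp_apply] at h1
  rw [canonicalHermitian_squashed_apply hp hJ h hY, verticalProj_of_mem_horizontal (hYh x),
    smul_zero, sub_zero, h1]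
  convert horizontalProj_mem EN g p x (leviCivita g Y x u) using 1
  simp [horizontalProj, sub_eq_add_neg]

end nearlyKahler

/-! ### Parallel transport and holonomy -/

/-- A symmetric field of bilinear forms is parallel for `D`. -/
def IsParallelForm (D : (Π y : M, TangentSpace 𝓘(ℝ, E) y) → EndField E M)
    (B : BilinField E M) : Prop :=
  ∀ (x : M) (Y : Π y : M, TangentSpace 𝓘(ℝ, E) y) (u : TangentSpace 𝓘(ℝ, E) x),
    MDiffAt (T% Y) x → d% (fun y => B y (Y y) (Y y)) x u = 2 * B x (D Y x u) (Y x)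

/-- A parallel form is constant on a parallel vector field along a curve. -/
theorem IsParallelForm.apply_eq_of_isParallelAlong
    {D : (Π y : M, TangentSpace 𝓘(ℝ, E) y) → EndField E M} {B : BilinField E M}
    (hB : ∀ x, SmoothBilinAt B x) (hsymm : ∀ x u v, B x u v = B x v u) (hBD : IsParallelForm D B)
    {c : ℝ → M} {a b : ℝ} (hab : a < b) (hc : ContMDiffOn 𝓘(ℝ, ℝ) 𝓘(ℝ, E) 1 c (Set.Icc a b))
    {Y : Π s : ℝ, TangentSpace 𝓘(ℝ, E) (c s)} (hY : IsParallelAlong D c (Set.Icc a b) Y) :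
    B (c b) (Y b) (Y b) = B (c a) (Y a) (Y a) := by
  have key : ∀ t ∈ Set.Icc a b,
      HasDerivWithinAt (fun s => B (c s) (Y s) (Y s)) 0 (Set.Icc a b) t := by
    intro t ht
    obtain ⟨hd, hcov⟩ := hY t ht
    have hv : HasMFDerivWithinAt 𝓘(ℝ, ℝ) 𝓘(ℝ, E) (alongCoord c Y t) (Set.Icc a b) t
        (ContinuousLinearMap.toSpanSingleton ℝ
          (derivWithin (alongCoord c Y t) (Set.Icc a b) t) : ℝ →L[ℝ] E) :=
      hd.hasDerivWithinAt.hasFDerivWithinAt.hasMFDerivWithinAt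
    obtain ⟨f', hf', hf'u⟩ := (hB (c t)).hasMFDerivWithinAt_along
      ((hc t ht).mdifferentiableWithinAt one_ne_zero).hasMFDerivWithinAt Y Y hv hv
    rw [Set.insert_eq_of_mem ht] at hf'
    -- Parallelism of B rewrites the derivative of its matrix as 2B(∇_{c'} e, Y), with e the
    -- constant-coefficient extension of Y(t). Together with the terms in the derivative of the
    -- coefficients this is 2B(∇_{c'} Y, Y) = 0.
    have h1 := hBD (c t) (extend E (Y t)) (mfderivWithin 𝓘(ℝ, ℝ) 𝓘(ℝ, E) c (Set.Icc a b) t (1 : ℝ))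
      (mdifferentiableAt_extend ..)
    rw [extend_apply_self] at h1
    have h2 : f' 1 = 0 := by
      have h3 := congr(2 * B (c t) $hcov (Y t))
      rw [covDerivAlong, map_add, map_zero, zero_apply, mul_zero, add_apply, mul_add] at h3
      refine (hf'u 1).trans ((congrArg₂ (· + ·) (congrArg₂ (· + ·) h1 rfl) (hsymm _ _ _)).trans ?_)
      rw [ContinuousLinearMap.toSpanSingleton_apply, one_smul]
      linarith
    have h4 : f' = 0 := by
      ext
      simpa using h2
    have h5 : HasFDerivWithinAt (fun s => B (c s) (Y s) (Y s)) f' (Set.Icc a b) t :=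
      hasMFDerivWithinAt_iff_hasFDerivWithinAt.1 hf'
    rw [h4] at h5
    simpa using h5.hasDerivWithinAt
  exact constant_of_derivWithin_zero (f := fun s => B (c s) (Y s) (Y s))
    (fun t ht => (key t ht).differentiableWithinAt)
    (fun t ht => (key t (Set.Ico_subset_Icc_self ht)).derivWithin
      (uniqueDiffOn_Icc hab t (Set.Ico_subset_Icc_self ht))) b (Set.right_mem_Icc.2 hab.le)

/-- Parallel transport preserves the null vectors of a parallel form. -/
theorem IsParallelForm.apply_eq_zero_of_isParallelTransport
    {D : (Π y : M, TangentSpace 𝓘(ℝ, E) y) → EndField E M} {B : BilinField E M}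
    (hB : ∀ x, SmoothBilinAt B x) (hsymm : ∀ x u v, B x u v = B x v u) (hBD : IsParallelForm D B)
    {x y : M} {τ : TangentSpace 𝓘(ℝ, E) x →ₗ[ℝ] TangentSpace 𝓘(ℝ, E) y}
    (hτ : IsParallelTransport D x y τ) :
    ∀ u, B x u u = 0 → B y (τ u) (τ u) = 0 := by
  induction hτ with
  | curve c a b hab hc τ hτ =>
    intro u hu
    obtain ⟨Y, hY, hYa, hYb⟩ := hτ u
    rw [← hYb, hBD.apply_eq_of_isParallelAlong hB hsymm hab hc hY, hYa, hu]
  | trans x y z σ τ _ _ hσ hτ => exact fun u hu => hτ _ (hσ u hu)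

/-- A subspace preserved by parallel transport along loops is preserved by the holonomy group. -/
theorem holonomyGroup_preserves {D : (Π y : M, TangentSpace 𝓘(ℝ, E) y) → EndField E M} {x : M}
    {W : Submodule ℝ (TangentSpace 𝓘(ℝ, E) x)}
    (h : ∀ τ, IsParallelTransport D x x τ → ∀ u ∈ W, τ u ∈ W) :
    ∀ τ ∈ holonomyGroup D x, ∀ u ∈ W, τ u ∈ W := by
  have : FiniteDimensional ℝ (TangentSpace 𝓘(ℝ, E) x) := inferInstanceAs (FiniteDimensional ℝ E)
  intro τ hτ
  induction hτ using Subgroup.closure_induction with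
  | mem τ hτ => exact h _ hτ
  | one => exact fun u hu => hu
  | mul σ τ _ _ hσ hτ => exact fun u hu => hσ _ (hτ u hu)
  | inv τ _ hτ =>
    intro u hu
    -- In finite dimension τW ⊆ W forces τW = W, so the inverse preserves W as well.
    have hle : W.map τ.toLinearMap ≤ W := Submodule.map_le_iff_le_comap.2 hτ
    have heq : W.map τ.toLinearMap = W :=
      Submodule.eq_of_le_of_finrank_eq hle (LinearEquiv.finrank_map_eq τ W)
    rw [← heq] at hu
    obtain ⟨w, hw, rfl⟩ := hu
    have : τ⁻¹ (τ.toLinearMap w) = w := τ.symm_apply_apply w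
    rwa [this]

/-! ### The vertical and horizontal parts of the metric as parallel forms -/

section forms

variable {g : RiemMetric E M} {gN : RiemMetric EN N} {p : M → N} {J : EndField E M}

variable (EN) in
/-- The form `g(𝒱u, 𝒱v)`. -/
def verticalForm (g : RiemMetric E M) (p : M → N) : BilinField E M :=
  fun x => (2 : ℝ) • (g.inner x - squashedInner EN g p x)

variable (EN) in
/-- The form `g(Hu, Hv)`, where `Hu` is the horizontal part of `u`. -/
def horizontalForm (g : RiemMetric E M) (p : M → N) : BilinField E M :=
  fun x => g.inner x - verticalForm EN g p x

variable (EN) in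
theorem verticalForm_apply (g : RiemMetric E M) (p : M → N) (x : M)
    (u v : TangentSpace 𝓘(ℝ, E) x) :
    verticalForm EN g p x u v = g.inner x (verticalProj EN g p x u) v := by
  simp only [verticalForm, smul_apply, sub_apply, squashedInner_eq_sub, smul_eq_mul]
  ring

variable (EN) in
theorem horizontalForm_apply (g : RiemMetric E M) (p : M → N) (x : M)
    (u v : TangentSpace 𝓘(ℝ, E) x) :
    horizontalForm EN g p x u v = g.inner x u v - g.inner x (verticalProj EN g p x u) v := by
  rw [horizontalForm, sub_apply, sub_apply, verticalForm_apply]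

theorem verticalForm_symm (x : M) (u v : TangentSpace 𝓘(ℝ, E) x) :
    verticalForm EN g p x u v = verticalForm EN g p x v u := by
  rw [verticalForm_apply, verticalForm_apply, inner_verticalProj_comm, g.symm]

theorem horizontalForm_symm (x : M) (u v : TangentSpace 𝓘(ℝ, E) x) :
    horizontalForm EN g p x u v = horizontalForm EN g p x v u := by
  rw [horizontalForm, sub_apply, sub_apply, sub_apply, sub_apply, verticalForm_symm, g.symm]

theorem RiemMetric.inner_self_eq_zero (g : RiemMetric E M) {x : M} {u : TangentSpace 𝓘(ℝ, E) x} :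
    g.inner x u u = 0 ↔ u = 0 :=
  ⟨fun h => by_contra fun hne => (g.pos x u hne).ne' h, fun h => by simp [h]⟩

/-- The value is the squared length of 𝒱u. The two distributions are thus null sets of quadratic
forms, so conservation of those forms controls parallel transport. -/
theorem verticalForm_self_eq_zero_iff (x : M) (u : TangentSpace 𝓘(ℝ, E) x) :
    verticalForm EN g p x u u = 0 ↔ u ∈ horizontalSpace EN g p x := by
  rw [verticalForm_apply, inner_verticalProj_left, g.inner_self_eq_zero]
  exact Submodule.projection_apply_eq_zero_iff (isCompl_vertical_horizontal EN g p x)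

theorem horizontalForm_self_eq_zero_iff (x : M) (u : TangentSpace 𝓘(ℝ, E) x) :
    horizontalForm EN g p x u u = 0 ↔ u ∈ verticalSpace E EN p x := by
  rw [horizontalForm_apply, inner_verticalProj_left, inner_eq_proj EN g p x u u,
    add_sub_cancel_left, g.inner_self_eq_zero]
  constructor
  · intro h
    have := verticalProj_mem EN g p x u
    rwa [← sub_eq_zero.1 (show u - verticalProj EN g p x u = 0 from h)] at this
  · intro h
    simp [horizontalProj, verticalProj_of_mem h]

theorem smoothBilinAt_verticalForm (hp : IsRiemannianSubmersion g gN p) (x : M) :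
    SmoothBilinAt (verticalForm EN g p) x :=
  ((g.smoothBilinAt x).sub (contMDiff_squashedInner hp x)).const_smul 2

theorem smoothBilinAt_horizontalForm (hp : IsRiemannianSubmersion g gN p) (x : M) :
    SmoothBilinAt (horizontalForm EN g p) x :=
  (g.smoothBilinAt x).sub (smoothBilinAt_verticalForm hp x)

/-- The derivative of 𝒱² = 𝒱 splits g(S v u, v) into two terms, which agree by self-adjointness. -/
theorem ProjDerivLaws.inner_apply_self {x : M}
    {S : TangentSpace 𝓘(ℝ, E) x →L[ℝ] TangentSpace 𝓘(ℝ, E) x →L[ℝ] TangentSpace 𝓘(ℝ, E) x}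
    (h : ProjDerivLaws EN g p J x S) (u v : TangentSpace 𝓘(ℝ, E) x) :
    g.inner x (S v u) v = 2 * g.inner x (verticalProj EN g p x (S v u)) v ∧
    g.inner x (S v u) v = 2 * g.inner x (S (verticalProj EN g p x v) u) v := by
  have h1 := congr(g.inner x $(h.proj_add_apply_proj u v) v)
  have h2 : g.inner x (S (verticalProj EN g p x v) u) v =
      g.inner x (verticalProj EN g p x (S v u)) v := by
    rw [h.inner_comm, inner_verticalProj_comm, g.symm, inner_verticalProj_comm]
  rw [map_add, add_apply] at h1
  constructor <;> linarith

/-- Differentiating g(𝒱Y, Y) with ∇ gives 2g(𝒱∇_u Y, Y) + g(S Y u, Y); the correction in the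
canonical connection supplies exactly 2g(𝒱(S Y u), Y). -/
theorem isParallelForm_verticalForm (hp : IsRiemannianSubmersion g gN p) (hJ : IsKahler g J)
    (h : ∀ x, ProjDerivLaws EN g p J x
      (covDerivTensor (leviCivita g) (hp.smoothEndAt_verticalProj x))) :
    IsParallelForm (canonicalHermitian (squashedMetric g gN p hp) (reversedJ EN g p J))
      (verticalForm EN g p) := by
  intro x Y u hY
  have hS := hp.smoothEndAt_verticalProj x
  have h1 := (leviCivita_isLeviCivita g).metric x _ _ u (hS.mdiffAt_apply hY) hY
  have h2 := congr(g.inner x $(congr($(covDerivTensor_apply (leviCivita g) hS hY) u)) (Y x))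
  have h3 := ((h x).inner_apply_self u (Y x)).1
  simp only [verticalForm_apply] at h1 ⊢
  rw [h1, canonicalHermitian_squashed_apply hp hJ h hY]
  simp only [covDerivEnd, sub_apply, ContinuousLinearMap.comp_apply, map_sub, map_add, map_smul,
    smul_apply, add_apply, (h x).proj_apply_proj, smul_zero, sub_zero] at h2 ⊢
  rw [inner_verticalProj_comm EN g p x (Y x), g.symm x (Y x)]
  linarith

theorem isParallelForm_horizontalForm (hp : IsRiemannianSubmersion g gN p) (hJ : IsKahler g J)
    (h : ∀ x, ProjDerivLaws EN g p J x
      (covDerivTensor (leviCivita g) (hp.smoothEndAt_verticalProj x))) :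
    IsParallelForm (canonicalHermitian (squashedMetric g gN p hp) (reversedJ EN g p J))
      (horizontalForm EN g p) := by
  intro x Y u hY
  have hS := hp.smoothEndAt_verticalProj x
  have h1 := (leviCivita_isLeviCivita g).metric x _ _ u hY hY
  have h2 := isParallelForm_verticalForm hp hJ h x Y u hY
  have h3 := ((h x).inner_apply_self u (Y x)).2
  have h4 : (fun y => horizontalForm EN g p y (Y y) (Y y)) = fun y =>
      g.inner y (Y y) (Y y) - verticalForm EN g p y (Y y) (Y y) := rfl
  have h5 : MDiffAt (fun y => verticalForm EN g p y (Y y) (Y y)) x := by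
    simp only [verticalForm_apply]
    exact g.mdiffAt (hS.mdiffAt_apply hY) hY
  rw [h4, mvfderiv_fun_sub (g.mdiffAt hY hY) h5, sub_apply, h1, h2, horizontalForm, sub_apply,
    sub_apply, g.symm x (Y x)]
  -- The correction S (Y - 2𝒱Y) u is orthogonal to Y, so the canonical connection also preserves g;
  -- subtracting the vertical form finishes.
  have h6 : g.inner x (canonicalHermitian (squashedMetric g gN p hp) (reversedJ EN g p J) Y x u)
      (Y x) = g.inner x (leviCivita g Y x u) (Y x) := by
    rw [canonicalHermitian_squashed_apply hp hJ h hY]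
    simp only [map_sub, map_add, map_smul, sub_apply, smul_apply, add_apply, smul_eq_mul]
    linarith
  rw [h6]
  ring

end forms

/-! ### Properness of the vertical space -/

theorem verticalSpace_ne_bot (p : M → N) (x : M)
    (hlt : Module.finrank ℝ EN < Module.finrank ℝ E) : verticalSpace E EN p x ≠ ⊥ := by
  have : FiniteDimensional ℝ (TangentSpace 𝓘(ℝ, E) x) := inferInstanceAs (FiniteDimensional ℝ E)
  have : FiniteDimensional ℝ (TangentSpace 𝓘(ℝ, EN) (p x)) :=
    inferInstanceAs (FiniteDimensional ℝ EN)
  exact LinearMap.ker_ne_bot_of_finrank_lt hlt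

theorem verticalSpace_ne_top {p : M → N} {x : M}
    (hsurj : Function.Surjective (mfderiv 𝓘(ℝ, E) 𝓘(ℝ, EN) p x))
    (h0 : 0 < Module.finrank ℝ EN) : verticalSpace E EN p x ≠ ⊤ := by
  intro h
  obtain ⟨w, hw⟩ := (Module.finrank_pos_iff_exists_ne_zero (R := ℝ) (M := EN)).1 h0
  obtain ⟨u, hu⟩ := hsurj w
  have hmem : u ∈ verticalSpace E EN p x := h ▸ Submodule.mem_top
  exact hw (hu.symm.trans hmem)

end

theorem proposition3p1
    {E : Type*} [NormedAddCommGroup E] [NormedSpace ℝ E] [FiniteDimensional ℝ E]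
    {M : Type*} [TopologicalSpace M] [ChartedSpace E M] [IsManifold 𝓘(ℝ, E) ∞ M]
    {EN : Type*} [NormedAddCommGroup EN] [NormedSpace ℝ EN] [FiniteDimensional ℝ EN]
    {N : Type*} [TopologicalSpace N] [ChartedSpace EN N] [IsManifold 𝓘(ℝ, EN) ∞ N]
    (g : RiemMetric E M) (gN : RiemMetric EN N) (p : M → N)
    (hp : IsRiemannianSubmersion g gN p) (hgeo : HasTotallyGeodesicFibers EN g p)
    (J : EndField E M) (hJ : IsKahler g J)
    (hV : ∀ x, ∀ u ∈ verticalSpace E EN p x, J x u ∈ verticalSpace E EN p x)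
    (hH : ∀ x, ∀ u ∈ horizontalSpace EN g p x, J x u ∈ horizontalSpace EN g p x) :
    IsNearlyKahler (squashedMetric g gN p hp) (reversedJ EN g p J) ∧
    IsParallelDistribution
      (canonicalHermitian (squashedMetric g gN p hp) (reversedJ EN g p J))
      (verticalSpace E EN p) ∧
    IsParallelDistribution
      (canonicalHermitian (squashedMetric g gN p hp) (reversedJ EN g p J))
      (horizontalSpace EN g p) ∧
    (∀ x, ∀ τ ∈ holonomyGroup
        (canonicalHermitian (squashedMetric g gN p hp) (reversedJ EN g p J)) x,
      (∀ u ∈ verticalSpace E EN p x, τ u ∈ verticalSpace E EN p x) ∧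
      (∀ u ∈ horizontalSpace EN g p x, τ u ∈ horizontalSpace EN g p x)) ∧
    (0 < Module.finrank ℝ EN → Module.finrank ℝ EN < Module.finrank ℝ E →
      HasReducibleHolonomy
        (canonicalHermitian (squashedMetric g gN p hp) (reversedJ EN g p J))) := by
  have h := projDerivLaws hp hgeo hJ hV hH
  have hhol : ∀ x, ∀ τ ∈ holonomyGroup
      (canonicalHermitian (squashedMetric g gN p hp) (reversedJ EN g p J)) x,
      (∀ u ∈ verticalSpace E EN p x, τ u ∈ verticalSpace E EN p x) ∧
      (∀ u ∈ horizontalSpace EN g p x, τ u ∈ horizontalSpace EN g p x) := by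
    intro x τ hτ
    constructor
    -- Vertical vectors are the null vectors of the horizontal form, which parallel transport
    -- conserves; the horizontal case exchanges the roles.
    · refine holonomyGroup_preserves (fun σ hσ u hu => ?_) τ hτ
      rw [← horizontalForm_self_eq_zero_iff (g := g)] at hu ⊢
      exact (isParallelForm_horizontalForm hp hJ h).apply_eq_zero_of_isParallelTransport
        (smoothBilinAt_horizontalForm hp) horizontalForm_symm hσ u hu
    · refine holonomyGroup_preserves (fun σ hσ u hu => ?_) τ hτ
      rw [← verticalForm_self_eq_zero_iff] at hu ⊢
      exact (isParallelForm_verticalForm hp hJ h).apply_eq_zero_of_isParallelTransport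
        (smoothBilinAt_verticalForm hp) verticalForm_symm hσ u hu
  refine ⟨isNearlyKahler_squashed hp hJ h, isParallelDistribution_vertical hp hJ h,
    isParallelDistribution_horizontal hp hJ h, hhol, fun h0 hlt x => ?_⟩
  exact ⟨verticalSpace E EN p x, verticalSpace_ne_bot p x hlt,
    verticalSpace_ne_top (hp.surjective_mfderiv x) h0, fun τ hτ => (hhol x τ hτ).1⟩
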